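/- For integers $m\ge 0$ let $V_m(x)=\frac1{m!}\int_0^\infty \frac{u^m e^{-u}}{\sqrt{x^2+u}}\,du$ be the Coulomb potential regularized by the lowest-band Landau state of angular momentum $-m$, and put $V_{-1}(x)=1/|x|$. For $Z>0$, $M>0$ and measurable real functions $V_j$ ($1\le j\le N$) and $W_{jk}$ ($1\le j<k\le N$) on $\mathbb R$, let $$h(N,Z,M)=\sum_{j=1}^N\Big[-\frac1M\frac{d^2}{dx_j^2}-Z\,V_j(x_j)\Big]+\sum_{j<k}W_{jk}(x_j-x_k)$$ on $L^2(\mathbb R^N)$, let $E_0(N)\in(-\infty,\infty]$ be the infimum of $\langle\Phi,h\Phi\rangle$ over normalized $\Phi\in H^1(\mathbb R^N)$ with finite potential energy, and let $E_0^{(k)}(N-1)$ be the corresponding infimum for the $(N-1)$-particle Hamiltonian obtained from $h$ by omitting all terms that involve $x_k$. We say that $h$ has a bound state if $E_0(N)<\min_k E_0^{(k)}(N-1)$. We say that the potential bounds hold with $\mu,\nu$ if $$V_j(x)\le V_\mu(x)\qquad\text{and}\qquad W_{jk}(x)\ge \tfrac1{\sqrt2}\,V_{\nu-1}\big(\tfrac{x}{\sqrt2}\big)$$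 for all $j$, all $j<k$ and all $x$ (with $x\neq0$ in the second bound if $\nu=0$). Corollary 3. Let $a>0$, $p>3$ and $Z_0>1$. There is a constant $A>0$, depending only on $a$, $p$ and $Z_0$, such that the following holds for all real $Z\ge Z_0$ and $B=aZ^p$. (i) If the potential bounds hold with integers $0\le\nu\le2\mu$, and $N>3Z+A\,Z(\log Z)^2$, then the Hamiltonian $h(N,Z,B^{-1/2})$ has no bound state. (ii) Suppose that potentials are given for every $N$ (possibly depending on $N$) and that for every $N$ the potential bounds hold with some integers $0\le\nu_N\le2\mu_N$. Let $N_{\max}(Z,B)$ be the largest $N$ for which $h(N,Z,B^{-1/2})$ has a bound state. Then $N_{\max}(Z,B)$ is finite and $N_{\max}(Z,B)\le 3Z+A\,Z(\log Z)^2$. -/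

import Mathlib

open MeasureTheory Filter Topology
open scoped ContDiff

noncomputable section

namespace StrongField

/-- The Coulomb potential regularized by the Landau state of angular momentum `-m` (field strength
one): `V_m(x) = (1 / m!) ∫₀^∞ u^m e^{-u} / √(x² + u) du`, which is the expectation of `1 / |r|` in
the normalized state with density `|ζ|^{2m} e^{-|ζ|²} / (π m!)`. -/
def regCoulomb (m : ℕ) (x : ℝ) : ℝ :=
  (1 / (m.factorial : ℝ)) * ∫ u in Set.Ioi (0 : ℝ), u ^ m * Real.exp (-u) / √(x ^ 2 + u)

/-- `V_{ν-1}` for `ν ≥ 0`. For `ν = 0` the symbol `V_{-1}` has its limiting meaning `1 / |x|`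
(the probability density `u^m e^{-u} / Γ(m+1)` concentrates at `u = 0` as `m → -1`). -/
def regCoulombPred : ℕ → ℝ → ℝ
  | 0, x => 1 / |x|
  | m + 1, x => regCoulomb m x

section System

variable {ι : Type*} [Fintype ι] [LinearOrder ι]

/-- `Φ` belongs to the Sobolev space `H¹(ℝ^ι)` and has the weak partial derivatives `g i`:
`(Φ, g)` is an `L²` limit of smooth compactly supported functions and their partial derivatives. -/
def HasSobolevGradient (Φ : (ι → ℝ) → ℂ) (g : ι → (ι → ℝ) → ℂ) : Prop :=
  MemLp Φ 2 volume ∧ (∀ i, MemLp (g i) 2 volume) ∧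
    ∃ φ : ℕ → (ι → ℝ) → ℂ,
      (∀ n, ContDiff ℝ ∞ (φ n) ∧ HasCompactSupport (φ n)) ∧
      Tendsto (fun n => eLpNorm (fun x => φ n x - Φ x) 2 volume) atTop (𝓝 0) ∧
      ∀ i, Tendsto
        (fun n => eLpNorm (fun x => fderiv ℝ (φ n) x (Pi.single i 1) - g i x) 2 volume)
        atTop (𝓝 0)

/-- The total potential `- Z ∑_j V_j(x_j) + ∑_{j<k} W_{jk}(x_j - x_k)`. -/
def totalPotential (Z : ℝ) (V : ι → ℝ → ℝ) (W : ι → ι → ℝ → ℝ) (x : ι → ℝ) : ℝ :=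
  -Z * ∑ j, V j (x j) + ∑ j, ∑ k with j < k, W j k (x j - x k)

/-- The values `⟨Φ, h Φ⟩` on normalized `Φ` of the form domain (`Φ ∈ H¹` with finite potential
energy) of
`h = ∑_j [-(1/M) d²/dx_j² - Z V_j(x_j)] + ∑_{j<k} W_{jk}(x_j - x_k)`. -/
def energyValues (Z M : ℝ) (V : ι → ℝ → ℝ) (W : ι → ι → ℝ → ℝ) : Set ℝ :=
  {e | ∃ (Φ : (ι → ℝ) → ℂ) (g : ι → (ι → ℝ) → ℂ),
    HasSobolevGradient Φ g ∧
    Integrable (fun x => totalPotential Z V W x * ‖Φ x‖ ^ 2) volume ∧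
    ∫ x, ‖Φ x‖ ^ 2 = 1 ∧
    e = 1 / M * (∑ i, (∫ x, ‖g i x‖ ^ 2)) + (∫ x, totalPotential Z V W x * ‖Φ x‖ ^ 2)}

/-- The ground state energy `inf_{‖Φ‖ = 1} ⟨Φ, h Φ⟩`. -/
def groundEnergy (Z M : ℝ) (V : ι → ℝ → ℝ) (W : ι → ι → ℝ → ℝ) : EReal :=
  ⨅ e ∈ energyValues Z M V W, (e : EReal)

/-- The ground state energy of the system from which particle `k` has been removed: all the terms
of the Hamiltonian that involve `x_k` are omitted, the other potentials are kept. -/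
def groundEnergyRemove (Z M : ℝ) (V : ι → ℝ → ℝ) (W : ι → ι → ℝ → ℝ) (k : ι) : EReal :=
  groundEnergy (ι := {j : ι // j ≠ k}) Z M (fun j => V j) (fun i j => W i j)

/-- The Hamiltonian has a bound state: its ground state energy lies strictly below that of every
system with one particle less. -/
def HasBoundState (Z M : ℝ) (V : ι → ℝ → ℝ) (W : ι → ι → ℝ → ℝ) : Prop :=
  groundEnergy Z M V W < ⨅ k, groundEnergyRemove Z M V W k

/-- The bounds `V_j(x) ≤ V_μ(x)` and `W_{jk}(x) ≥ (1/√2) V_{ν-1}(x/√2)` on (measurable)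
effective potentials. -/
def PotentialBounds (μ ν : ℕ) (V : ι → ℝ → ℝ) (W : ι → ι → ℝ → ℝ) : Prop :=
  (∀ j, Measurable (V j)) ∧ (∀ j k, j < k → Measurable (W j k)) ∧
  (∀ j x, V j x ≤ regCoulomb μ x) ∧
  (∀ j k, j < k → ∀ x, 1 / √2 * regCoulombPred ν (x / √2) ≤ W j k x)

end System

/-- For a model that prescribes effective potentials for each number `N` of electrons: the largest
`N` for which the `N`-electron Hamiltonian has a bound state (`⊤` if there are arbitrarily large
such `N`). -/
def maxElectrons (Z M : ℝ) (V : (N : ℕ) → Fin N → ℝ → ℝ)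
    (W : (N : ℕ) → Fin N → Fin N → ℝ → ℝ) : ℕ∞ :=
  ⨆ N ∈ {N : ℕ | HasBoundState Z M (V N) (W N)}, (N : ℕ∞)

end StrongField

end

/-!
Let `E` be the ground state energy and `E' > E` a lower bound for the energy of every system with
one particle less. For a near-minimizer `Φ` and a cutoff `q` that increases with `|x_k|`, the IMS
formula splits the energy of `Φ` into those of `√(1 - q(x_k)) Φ` and `√(q(x_k)) Φ`, up to a
localization error. The first is at least `E` times the squared norm. In the second particle `k` may
be removed, which leaves at least `E'` times the squared norm, plus the repulsion of `k` by the
others, minus its attraction by the nucleus. So the `q`-weighted repulsion is bounded by the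
`q`-weighted attraction and the localization error.

The cutoff is `q = ε φ / (1 + ε φ)` with `φ(x) = √(x² + s)`. The weighted attraction is then at most
`3 Z ε`. As `φ(x) + φ(y)` dominates the denominator `√((x - y)² + 4 s)` of the repulsion, summing
over `k` makes the weighted repulsions at least about `ε N² / 2`, hence `N ≤ 6 Z + …`. The
localization error is `ε` times the expectation of `1 / √(x_k² + 1)`. That expectation is of order
`Z M (log L)² + 1 / L` by a one-dimensional uncertainty principle, because `1 / √(x² + 1)` is the
derivative of a function of size `log L` up to an error `1 / √(x² + L²)`. The field strength enters
through `M = B ^ (-1 / 2)`, and `L` is chosen with `L M` bounded below.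
-/

namespace StrongField

/-- The smoothed modulus `√(x² + s)` of a real number `x`; the regularized Coulomb potential of
index `m` is comparable to `1 / softAbs (m + 1) x`. -/
noncomputable def softAbs (s x : ℝ) : ℝ := √(x ^ 2 + s)

section SoftAbs

variable {r s : ℝ}

theorem softAbs_pos (hs : 0 < s) (x : ℝ) : 0 < softAbs s x :=
  Real.sqrt_pos.2 (by positivity)

theorem sq_softAbs (hs : 0 ≤ s) (x : ℝ) : softAbs s x ^ 2 = x ^ 2 + s :=
  Real.sq_sqrt (by positivity)

theorem softAbs_le_softAbs (hrs : r ≤ s) (x : ℝ) : softAbs r x ≤ softAbs s x :=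
  Real.sqrt_le_sqrt (by linarith)

theorem one_div_softAbs_anti (hr : 0 < r) (hrs : r ≤ s) (x : ℝ) :
    1 / softAbs s x ≤ 1 / softAbs r x :=
  one_div_le_one_div_of_le (softAbs_pos hr x) (softAbs_le_softAbs hrs x)

theorem one_le_softAbs (hs : 1 ≤ s) (x : ℝ) : 1 ≤ softAbs s x :=
  Real.one_le_sqrt.2 (by linarith [sq_nonneg x])

theorem one_div_softAbs_le_one (hs : 1 ≤ s) (x : ℝ) : 1 / softAbs s x ≤ 1 :=
  div_le_one_of_le₀ (one_le_softAbs hs x) (zero_le_one.trans (one_le_softAbs hs x))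

@[fun_prop]
theorem measurable_softAbs (s : ℝ) : Measurable (softAbs s) := by
  unfold softAbs
  fun_prop

theorem contDiff_softAbs (hs : 0 < s) : ContDiff ℝ ∞ (softAbs s) :=
  ContDiff.sqrt (by fun_prop) fun x => by positivity

theorem hasDerivAt_softAbs (hs : 0 < s) (x : ℝ) : HasDerivAt (softAbs s) (x / softAbs s x) x := by
  have hx : x ^ 2 + s ≠ 0 := by positivity
  refine (((hasDerivAt_pow 2 x).add_const s).sqrt hx).congr_deriv ?_
  rw [softAbs, Nat.add_one_sub_one, pow_one, Nat.cast_ofNat, mul_div_mul_left x _ two_ne_zero]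

theorem softAbs_sub_le (hs : 0 ≤ s) (x y : ℝ) :
    softAbs (4 * s) (x - y) ≤ softAbs s x + softAbs s y := by
  have cauchy_schwarz : -(x * y) + s ≤ softAbs s x * softAbs s y := by
    unfold softAbs
    rw [← Real.sqrt_mul (by positivity)]
    refine Real.le_sqrt_of_sq_le ?_
    linarith [mul_nonneg hs (sq_nonneg (x + y))]
  refine Real.sqrt_le_iff.2 ⟨add_nonneg (Real.sqrt_nonneg _) (Real.sqrt_nonneg _), ?_⟩
  linarith [sq_softAbs hs x, sq_softAbs hs y]

end SoftAbs

section RegCoulomb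

theorem integrableOn_pow_mul_exp_neg (m : ℕ) :
    IntegrableOn (fun u : ℝ => u ^ m * Real.exp (-u)) (Set.Ioi 0) := by
  refine (Real.GammaIntegral_convergent (s := m + 1) (by positivity)).congr_fun
    (fun u _ => ?_) measurableSet_Ioi
  simp [mul_comm]

theorem integral_pow_mul_exp_neg (m : ℕ) :
    ∫ u in Set.Ioi (0 : ℝ), u ^ m * Real.exp (-u) = m.factorial := by
  rw [← Real.Gamma_nat_eq_factorial, Real.Gamma_eq_integral (by positivity)]
  refine setIntegral_congr_fun measurableSet_Ioi fun u _ => ?_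
  simp [mul_comm]

theorem pow_mul_exp_neg_div_sqrt_eq (m : ℕ) {u : ℝ} (hu : 0 < u) :
    u ^ m * Real.exp (-u) / √u = Real.exp (-u) * u ^ (((m : ℝ) + 1 / 2) - 1) := by
  rw [show ((m : ℝ) + 1 / 2) - 1 = m - 1 / 2 by ring, Real.rpow_sub hu, Real.rpow_natCast,
    Real.sqrt_eq_rpow]
  ring

theorem integrableOn_pow_mul_exp_neg_div_sqrt (m : ℕ) :
    IntegrableOn (fun u : ℝ => u ^ m * Real.exp (-u) / √u) (Set.Ioi 0) :=
  (Real.GammaIntegral_convergent (s := m + 1 / 2) (by positivity)).congr_fun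
    (fun _ hu => (pow_mul_exp_neg_div_sqrt_eq m hu).symm) measurableSet_Ioi

theorem integral_pow_mul_exp_neg_div_sqrt (m : ℕ) :
    ∫ u in Set.Ioi (0 : ℝ), u ^ m * Real.exp (-u) / √u = Real.Gamma (m + 1 / 2) := by
  rw [Real.Gamma_eq_integral (by positivity)]
  exact setIntegral_congr_fun measurableSet_Ioi fun _ hu => pow_mul_exp_neg_div_sqrt_eq m hu

theorem sq_Gamma_add_half_le (m : ℕ) :
    ((m : ℝ) + 1) * Real.Gamma (m + 1 / 2) ^ 2 ≤ (2 * m.factorial) ^ 2 := by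
  induction m with
  | zero =>
    simp only [Nat.cast_zero, zero_add, Real.Gamma_one_half_eq, Real.sq_sqrt Real.pi_pos.le]
    norm_num
    exact Real.pi_le_four
  | succ m ih =>
    have hrec : Real.Gamma (((m + 1 : ℕ) : ℝ) + 1 / 2)
        = ((m : ℝ) + 1 / 2) * Real.Gamma (m + 1 / 2) := by
      rw [← Real.Gamma_add_one (by positivity)]
      push_cast
      ring_nf
    have hcoeff : ((m : ℝ) + 1 + 1) * (m + 1 / 2) ^ 2 ≤ (m + 1) ^ 3 := by
      nlinarith [sq_nonneg (m : ℝ), (Nat.cast_nonneg m : (0 : ℝ) ≤ m)]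
    rw [hrec, Nat.factorial_succ]
    push_cast
    set G := Real.Gamma ((m : ℝ) + 1 / 2)
    calc ((m : ℝ) + 1 + 1) * ((m + 1 / 2) * G) ^ 2
        = (((m : ℝ) + 1 + 1) * (m + 1 / 2) ^ 2) * G ^ 2 := by ring
      _ ≤ (m + 1) ^ 3 * G ^ 2 := by gcongr
      _ = (m + 1) ^ 2 * ((m + 1) * G ^ 2) := by ring
      _ ≤ (m + 1) ^ 2 * (2 * (m.factorial : ℝ)) ^ 2 := by gcongr
      _ = _ := by ring

theorem sqrt_mul_Gamma_add_half_le (m : ℕ) :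
    √((m : ℝ) + 1) * Real.Gamma (m + 1 / 2) ≤ 2 * m.factorial := by
  refine le_of_sq_le_sq ?_ (by positivity)
  rw [mul_pow, Real.sq_sqrt (by positivity)]
  exact sq_Gamma_add_half_le m

theorem integrableOn_regCoulomb (m : ℕ) (x : ℝ) :
    IntegrableOn (fun u : ℝ => u ^ m * Real.exp (-u) / √(x ^ 2 + u)) (Set.Ioi 0) := by
  refine (integrableOn_pow_mul_exp_neg_div_sqrt m).mono' ?_ ?_
  · exact Measurable.aestronglyMeasurable (by fun_prop)
  · filter_upwards [ae_restrict_mem measurableSet_Ioi] with u (hu : 0 < u)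
    rw [Real.norm_of_nonneg (by positivity)]
    gcongr
    linarith [sq_nonneg x]

theorem one_div_softAbs_le_mul {s u : ℝ} (hs : 0 < s) (hu : 0 < u) (x : ℝ) :
    1 / softAbs u x ≤ 1 / softAbs s x * (1 + √s / √u) := by
  have hsu : softAbs s x * √u ≤ softAbs u x * (√u + √s) := by
    refine le_of_sq_le_sq ?_ (mul_nonneg (softAbs_pos hu x).le (by positivity))
    have h : 0 ≤ (x ^ 2 + u) * (2 * √u * √s) + x ^ 2 * s + u ^ 2 := by positivity
    rw [mul_pow, mul_pow, sq_softAbs hs.le, sq_softAbs hu.le, add_sq, Real.sq_sqrt hu.le,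
      Real.sq_sqrt hs.le]
    linarith
  have := Real.sqrt_pos.2 hu
  have hu' := softAbs_pos hu x
  have hs' := softAbs_pos hs x
  rw [one_div_mul_eq_div, div_le_div_iff₀ hu' hs', one_mul]
  calc softAbs s x = softAbs s x * √u / √u := by field_simp
    _ ≤ softAbs u x * (√u + √s) / √u := by gcongr
    _ = (1 + √s / √u) * softAbs u x := by field_simp

theorem tangent_le_one_div_softAbs {s u : ℝ} (hs : 0 < s) (hu : 0 < u) (x : ℝ) :
    1 / softAbs s x - (u - s) / (2 * softAbs s x ^ 3) ≤ 1 / softAbs u x := by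
  have hs' := softAbs_pos hs x
  have hu' := softAbs_pos hu x
  have hdiff : u - s = softAbs u x ^ 2 - softAbs s x ^ 2 := by
    rw [sq_softAbs hs.le, sq_softAbs hu.le]
    ring
  rw [hdiff, ← sub_nonneg]
  set q := softAbs s x
  set r := softAbs u x
  calc 0 ≤ (r - q) ^ 2 * (r + 2 * q) / (2 * q ^ 3 * r) := by positivity
    _ = 1 / r - (1 / q - (r ^ 2 - q ^ 2) / (2 * q ^ 3)) := by
      field_simp
      ring

theorem regCoulomb_le (m : ℕ) (x : ℝ) : regCoulomb m x ≤ 3 / softAbs (m + 1) x := by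
  have hs : (0 : ℝ) < m + 1 := by positivity
  have hq := softAbs_pos hs x
  have hint := (integrableOn_pow_mul_exp_neg_div_sqrt m).const_mul √((m : ℝ) + 1)
  have hI : ∫ u in Set.Ioi (0 : ℝ), u ^ m * Real.exp (-u) / √(x ^ 2 + u)
      ≤ 1 / softAbs (m + 1) x * (m.factorial + √((m : ℝ) + 1) * Real.Gamma (m + 1 / 2)) := by
    rw [← integral_pow_mul_exp_neg, ← integral_pow_mul_exp_neg_div_sqrt, ← integral_const_mul,
      ← integral_add (integrableOn_pow_mul_exp_neg m) hint, ← integral_const_mul]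
    refine setIntegral_mono_on (integrableOn_regCoulomb m x)
      (((integrableOn_pow_mul_exp_neg m).add hint).const_mul _) measurableSet_Ioi
      fun u (hu : 0 < u) => ?_
    calc u ^ m * Real.exp (-u) / √(x ^ 2 + u)
        = u ^ m * Real.exp (-u) * (1 / softAbs u x) := by
          unfold softAbs
          ring
      _ ≤ u ^ m * Real.exp (-u) * (1 / softAbs (m + 1) x * (1 + √((m : ℝ) + 1) / √u)) := by
          gcongr
          exact one_div_softAbs_le_mul hs hu x
      _ = _ := by ring
  calc regCoulomb m x
      ≤ 1 / (m.factorial : ℝ) *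
          (1 / softAbs (m + 1) x * (m.factorial + 2 * m.factorial)) := by
        refine mul_le_mul_of_nonneg_left (hI.trans ?_) (by positivity)
        gcongr ?_ * (_ + ?_)
        exact sqrt_mul_Gamma_add_half_le m
    _ = 3 / softAbs (m + 1) x := by
        field_simp
        ring

/-- Jensen's inequality for `u ↦ 1 / √(x² + u)` under the Gamma distribution of mean `m + 1`. -/
theorem le_regCoulomb (m : ℕ) (x : ℝ) : 1 / softAbs (m + 1) x ≤ regCoulomb m x := by
  have hs : (0 : ℝ) < m + 1 := by positivity
  have hq := softAbs_pos hs x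
  set q := softAbs (m + 1) x
  have hint := (integrableOn_pow_mul_exp_neg m).const_mul (1 / q + (m + 1) / (2 * q ^ 3))
  have hint' := (integrableOn_pow_mul_exp_neg (m + 1)).const_mul (1 / (2 * q ^ 3))
  have hI : (1 / q + (m + 1) / (2 * q ^ 3)) * m.factorial - 1 / (2 * q ^ 3) * (m + 1).factorial
      ≤ ∫ u in Set.Ioi (0 : ℝ), u ^ m * Real.exp (-u) / √(x ^ 2 + u) := by
    rw [← integral_pow_mul_exp_neg, ← integral_pow_mul_exp_neg, ← integral_const_mul,
      ← integral_const_mul, ← integral_sub hint hint']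
    refine setIntegral_mono_on (hint.sub hint') (integrableOn_regCoulomb m x) measurableSet_Ioi
      fun u (hu : 0 < u) => ?_
    calc _ = u ^ m * Real.exp (-u) * (1 / q - (u - (m + 1)) / (2 * q ^ 3)) := by ring
      _ ≤ u ^ m * Real.exp (-u) * (1 / softAbs u x) := by
          gcongr
          exact tangent_le_one_div_softAbs hs hu x
      _ = _ := by
          unfold softAbs
          ring
  calc 1 / q = 1 / (m.factorial : ℝ) * ((1 / q + (m + 1) / (2 * q ^ 3)) * m.factorial
        - 1 / (2 * q ^ 3) * (m + 1).factorial) := by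
        rw [Nat.factorial_succ]
        push_cast
        field_simp
        ring
    _ ≤ regCoulomb m x := mul_le_mul_of_nonneg_left hI (by positivity)

theorem le_regCoulombPred (ν : ℕ) (x : ℝ) : 1 / softAbs ν x ≤ regCoulombPred ν x := by
  cases ν with
  | zero => simp [softAbs, regCoulombPred, Real.sqrt_sq_eq_abs]
  | succ m => simpa [regCoulombPred] using le_regCoulomb m x

theorem le_regCoulombPred_div_sqrt_two (ν : ℕ) (x : ℝ) :
    1 / softAbs (2 * ν) x ≤ 1 / √2 * regCoulombPred ν (x / √2) := by
  refine le_trans (le_of_eq ?_)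
    (mul_le_mul_of_nonneg_left (le_regCoulombPred ν (x / √2)) (by positivity))
  rw [one_div_mul_one_div, softAbs, softAbs, ← Real.sqrt_mul (by norm_num), div_pow,
    Real.sq_sqrt (by norm_num)]
  congr 2
  ring

end RegCoulomb

section SaturatedWeight

/-- The function `ε φ / (1 + ε φ)` of `φ = √(x² + s)`, increasing in `|x|` with values in `(0, 1)`:
the weight with which an electron at `x` counts as far from the nucleus. -/
noncomputable def saturatedWeight (ε s x : ℝ) : ℝ := ε * softAbs s x / (1 + ε * softAbs s x)

variable {ε s : ℝ}

theorem saturatedWeight_pos (hε : 0 < ε) (hs : 0 < s) (x : ℝ) : 0 < saturatedWeight ε s x := by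
  have := softAbs_pos hs x
  unfold saturatedWeight
  positivity

theorem one_sub_saturatedWeight (hε : 0 < ε) (hs : 0 < s) (x : ℝ) :
    1 - saturatedWeight ε s x = 1 / (1 + ε * softAbs s x) := by
  have := softAbs_pos hs x
  unfold saturatedWeight
  field_simp
  ring

theorem saturatedWeight_lt_one (hε : 0 < ε) (hs : 0 < s) (x : ℝ) : saturatedWeight ε s x < 1 := by
  have := softAbs_pos hs x
  rw [← sub_pos, one_sub_saturatedWeight hε hs]
  positivity

theorem contDiff_saturatedWeight (hε : 0 < ε) (hs : 0 < s) :
    ContDiff ℝ ∞ (saturatedWeight ε s) := by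
  have h := contDiff_const (c := ε).mul (contDiff_softAbs hs)
  refine h.div (contDiff_const.add h) fun x => ?_
  have := softAbs_pos hs x
  positivity

theorem hasDerivAt_saturatedWeight (hε : 0 < ε) (hs : 0 < s) (x : ℝ) :
    HasDerivAt (saturatedWeight ε s)
      (ε * (x / softAbs s x) / (1 + ε * softAbs s x) ^ 2) x := by
  have hφ := softAbs_pos hs x
  have h := (hasDerivAt_softAbs hs x).const_mul ε
  refine (h.div (h.const_add 1) (by positivity)).congr_deriv ?_
  ring

theorem mul_saturatedWeight_le (hε : 0 < ε) (hs : 0 < s) {c v x : ℝ} (hc : 0 ≤ c)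
    (hv : v ≤ c / softAbs s x) : v * saturatedWeight ε s x ≤ c * ε := by
  have hφ := softAbs_pos hs x
  have hq := saturatedWeight_pos hε hs x
  calc v * saturatedWeight ε s x ≤ c / softAbs s x * saturatedWeight ε s x := by gcongr
    _ = c * ε / (1 + ε * softAbs s x) := by
        unfold saturatedWeight
        field_simp
    _ ≤ c * ε := div_le_self (by positivity) (le_add_of_nonneg_right (by positivity))

theorem mul_one_sub_saturatedWeight_le (hε : 0 < ε) (hs : 0 < s) {v x y : ℝ}
    (hv : 1 / softAbs (4 * s) (x - y) ≤ v) :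
    ε * (1 - saturatedWeight ε s x - saturatedWeight ε s y)
      ≤ v * (saturatedWeight ε s x + saturatedWeight ε s y) := by
  have ha := softAbs_pos hs x
  have hb := softAbs_pos hs y
  have hv' : 1 / (softAbs s x + softAbs s y) ≤ v :=
    (one_div_le_one_div_of_le (softAbs_pos (by positivity) _)
      (softAbs_sub_le hs.le x y)).trans hv
  unfold saturatedWeight
  set a := softAbs s x
  set b := softAbs s y
  calc ε * (1 - ε * a / (1 + ε * a) - ε * b / (1 + ε * b))
      = ε * (1 - ε ^ 2 * a * b) / ((1 + ε * a) * (1 + ε * b)) := by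
        field_simp
        ring
    _ ≤ ε * (1 + 2 * ε * a * b / (a + b)) / ((1 + ε * a) * (1 + ε * b)) := by
        gcongr ε * ?_ / _
        have h₁ : 0 ≤ ε ^ 2 * a * b := by positivity
        have h₂ : 0 ≤ 2 * ε * a * b / (a + b) := by positivity
        linarith
    _ = 1 / (a + b) * (ε * a / (1 + ε * a) + ε * b / (1 + ε * b)) := by
        field_simp
        ring
    _ ≤ v * (ε * a / (1 + ε * a) + ε * b / (1 + ε * b)) := by gcongr

theorem sq_deriv_sqrt_one_sub_add_sq_deriv_sqrt {q : ℝ → ℝ} {q' x : ℝ} (hq : HasDerivAt q q' x)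
    (h₀ : 0 < q x) (h₁ : q x < 1) :
    deriv (fun y => √(1 - q y)) x ^ 2 + deriv (fun y => √(q y)) x ^ 2
      = q' ^ 2 / (4 * q x * (1 - q x)) := by
  have h₁' : 0 < 1 - q x := sub_pos.2 h₁
  rw [((hq.const_sub 1).sqrt h₁'.ne').deriv, (hq.sqrt h₀.ne').deriv, div_pow, div_pow, mul_pow,
    mul_pow, Real.sq_sqrt h₁'.le, Real.sq_sqrt h₀.le]
  field_simp
  ring

theorem sq_deriv_sqrt_saturatedWeight_le (hε : 0 < ε) (hs : 1 ≤ s) (x : ℝ) :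
    deriv (fun y => √(1 - saturatedWeight ε s y)) x ^ 2
      + deriv (fun y => √(saturatedWeight ε s y)) x ^ 2 ≤ ε / 4 * (1 / softAbs 1 x) := by
  have hs' : 0 < s := by positivity
  have hφ := softAbs_pos hs' x
  rw [sq_deriv_sqrt_one_sub_add_sq_deriv_sqrt (hasDerivAt_saturatedWeight hε hs' x)
    (saturatedWeight_pos hε hs' x) (saturatedWeight_lt_one hε hs' x),
    one_sub_saturatedWeight hε hs']
  have hx : (x / softAbs s x) ^ 2 ≤ 1 := by
    rw [div_pow, div_le_one (by positivity), sq_softAbs hs'.le]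
    linarith
  calc (ε * (x / softAbs s x) / (1 + ε * softAbs s x) ^ 2) ^ 2
        / (4 * saturatedWeight ε s x * (1 / (1 + ε * softAbs s x)))
      = ε / 4 * (1 / softAbs s x) * ((x / softAbs s x) ^ 2 / (1 + ε * softAbs s x) ^ 2) := by
        unfold saturatedWeight
        field_simp
    _ ≤ ε / 4 * (1 / softAbs s x) * 1 := by
        gcongr
        exact div_le_one_of_le₀
          (hx.trans (one_le_pow₀ (le_add_of_nonneg_right (by positivity)))) (by positivity)
    _ ≤ ε / 4 * (1 / softAbs 1 x) := by
        rw [mul_one]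
        exact mul_le_mul_of_nonneg_left (one_div_softAbs_anti one_pos hs x) (by positivity)

end SaturatedWeight

section LogPrimitive

/-- A bounded primitive of `1 / √(x² + 1) - 1 / √(x² + L²)`. -/
noncomputable def logPrimitive (L x : ℝ) : ℝ := Real.arsinh x - Real.arsinh (x / L)

variable {L : ℝ}

theorem contDiff_logPrimitive (L : ℝ) : ContDiff ℝ ∞ (logPrimitive L) :=
  Real.contDiff_arsinh.sub (Real.contDiff_arsinh.comp (contDiff_id.div_const L))

theorem sqrt_one_add_sq_div (hL : 0 < L) (x : ℝ) :
    √(1 + (x / L) ^ 2) = softAbs (L ^ 2) x / L := by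
  rw [softAbs, eq_div_iff hL.ne', ← Real.sqrt_sq hL.le, ← Real.sqrt_mul (by positivity),
    Real.sqrt_sq hL.le]
  congr 1
  field_simp
  ring

theorem hasDerivAt_logPrimitive (hL : 0 < L) (x : ℝ) :
    HasDerivAt (logPrimitive L) (1 / softAbs 1 x - 1 / softAbs (L ^ 2) x) x := by
  refine ((Real.hasDerivAt_arsinh x).sub ((Real.hasDerivAt_arsinh (x / L)).comp x
    ((hasDerivAt_id x).div_const L))).congr_deriv ?_
  have hφ : √(1 + x ^ 2) = softAbs 1 x := by rw [softAbs, add_comm]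
  have hL' := softAbs_pos (pow_pos hL 2) x
  rw [sqrt_one_add_sq_div hL, hφ]
  field_simp

theorem logPrimitive_le (hL : 1 ≤ L) (x : ℝ) : logPrimitive L x ≤ Real.log L := by
  have hpos : 0 < x + √(1 + x ^ 2) := Real.exp_arsinh x ▸ Real.exp_pos _
  have hle : x + √(1 + x ^ 2) ≤ x + softAbs (L ^ 2) x := by
    rw [add_comm (1 : ℝ)]
    exact add_le_add_right (softAbs_le_softAbs (one_le_pow₀ hL) x) x
  have hL' : 0 < L := by positivity
  rw [logPrimitive, sub_le_iff_le_add, Real.arsinh, Real.arsinh, sqrt_one_add_sq_div hL', ← add_div,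
    Real.log_div (hpos.trans_le hle).ne' hL'.ne', add_sub_cancel]
  exact Real.log_le_log hpos hle

theorem logPrimitive_neg (L x : ℝ) : logPrimitive L (-x) = -logPrimitive L x := by
  rw [logPrimitive, logPrimitive, neg_div, Real.arsinh_neg, Real.arsinh_neg]
  ring

theorem abs_logPrimitive_le (hL : 1 ≤ L) (x : ℝ) : |logPrimitive L x| ≤ Real.log L :=
  abs_le'.2 ⟨logPrimitive_le hL x, logPrimitive_neg L x ▸ logPrimitive_le hL (-x)⟩

theorem one_div_softAbs_sq_le (hL : 0 < L) (x : ℝ) : 1 / softAbs (L ^ 2) x ≤ 1 / L :=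
  one_div_le_one_div_of_le hL (Real.le_sqrt_of_sq_le (by linarith [sq_nonneg x]))

theorem abs_deriv_logPrimitive_le (hL : 1 ≤ L) (x : ℝ) : |deriv (logPrimitive L) x| ≤ 1 := by
  have hL' : 0 < L := by positivity
  rw [(hasDerivAt_logPrimitive hL' x).deriv]
  exact abs_sub_le_of_nonneg_of_le (one_div_pos.2 (softAbs_pos one_pos x)).le
    (one_div_softAbs_le_one le_rfl x) (one_div_pos.2 (softAbs_pos (by positivity) x)).le
    (one_div_softAbs_le_one (one_le_pow₀ hL) x)

end LogPrimitive

section Lebesgue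

variable {α F : Type*} [MeasurableSpace α] {m : Measure α} [NormedAddCommGroup F]

theorem integrable_bdd_mul_sq {u : α → F} (hu : MemLp u 2 m) {f : α → ℝ}
    (hf : AEStronglyMeasurable f m) {C : ℝ} (hC : ∀ x, |f x| ≤ C) :
    Integrable (fun x => f x * ‖u x‖ ^ 2) m :=
  (hu.integrable_norm_pow two_ne_zero).bdd_mul hf (ae_of_all _ hC)

theorem tendsto_eLpNorm_add {p : ENNReal} (hp : 1 ≤ p) {u v : ℕ → α → F}
    (hum : ∀ n, AEStronglyMeasurable (u n) m) (hvm : ∀ n, AEStronglyMeasurable (v n) m)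
    (hu : Tendsto (fun n => eLpNorm (u n) p m) atTop (𝓝 0))
    (hv : Tendsto (fun n => eLpNorm (v n) p m) atTop (𝓝 0)) :
    Tendsto (fun n => eLpNorm (u n + v n) p m) atTop (𝓝 0) :=
  tendsto_of_tendsto_of_tendsto_of_le_of_le tendsto_const_nhds
    (by simpa only [add_zero] using hu.add hv) (fun _ => zero_le)
    fun n => eLpNorm_add_le (hum n) (hvm n) hp

theorem tendsto_eLpNorm_two_iff {u : ℕ → α → F} :
    Tendsto (fun n => eLpNorm (u n) 2 m) atTop (𝓝 0) ↔
      Tendsto (fun n => ∫⁻ x, ‖u n x‖ₑ ^ 2 ∂m) atTop (𝓝 0) := by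
  have hsq (n : ℕ) : ∫⁻ x, ‖u n x‖ₑ ^ 2 ∂m = eLpNorm (u n) 2 m ^ 2 :=
    by simpa using (eLpNorm_nnreal_pow_eq_lintegral (p := 2) (f := u n) (μ := m) two_ne_zero).symm
  simp only [hsq]
  refine ⟨fun h => by simpa using ENNReal.Tendsto.pow (n := 2) h, fun h => ?_⟩
  simpa [← ENNReal.rpow_natCast_mul] using h.ennrpow_const (2⁻¹ : ℝ)

theorem exists_seq_tendsto_zero_ae_of_lintegral {S : ℕ → α → ENNReal}
    (hS : ∀ n, AEMeasurable (S n) m) (h : Tendsto (fun n => ∫⁻ x, S n x ∂m) atTop (𝓝 0)) :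
    ∃ ns : ℕ → ℕ, ∀ᵐ x ∂m, Tendsto (fun j => S (ns j) x) atTop (𝓝 0) := by
  have hex (j : ℕ) : ∃ n, ∫⁻ x, S n x ∂m ≤ (2⁻¹ : ENNReal) ^ j :=
    (h.eventually (ge_mem_nhds (ENNReal.pow_pos (by simp) j))).exists
  choose ns hns using hex
  refine ⟨ns, ?_⟩
  have hfin : ∫⁻ x, ∑' j, S (ns j) x ∂m ≠ ⊤ := by
    rw [lintegral_tsum fun j => hS (ns j)]
    refine ne_top_of_le_ne_top ?_ (ENNReal.tsum_le_tsum hns)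
    simp [ENNReal.tsum_geometric]
  filter_upwards [ae_lt_top' (AEMeasurable.tsum fun j => hS (ns j)) hfin] with x hx
  exact ENNReal.tendsto_atTop_zero_of_tsum_ne_top hx.ne

theorem tendsto_eLpNorm_bdd_smul [NormedSpace ℝ F] {p : ENNReal} {c : α → ℝ} {C : ℝ}
    (hc : ∀ x, |c x| ≤ C) {u : ℕ → α → F}
    (hu : Tendsto (fun n => eLpNorm (u n) p m) atTop (𝓝 0)) :
    Tendsto (fun n => eLpNorm (c • u n) p m) atTop (𝓝 0) := by
  have hC : Tendsto (fun n => ENNReal.ofReal C * eLpNorm (u n) p m) atTop (𝓝 0) := by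
    simpa using ENNReal.Tendsto.const_mul hu (Or.inr ENNReal.ofReal_ne_top)
  refine tendsto_of_tendsto_of_tendsto_of_le_of_le tendsto_const_nhds hC (fun _ => zero_le)
    fun n => eLpNorm_le_mul_eLpNorm_of_ae_le_mul (ae_of_all _ fun x => ?_) p
  rw [Pi.smul_apply', norm_smul]
  exact mul_le_mul_of_nonneg_right (hc x) (norm_nonneg _)

theorem memLp_bdd_smul [NormedSpace ℝ F] {p : ENNReal} {c : α → ℝ} {C : ℝ}
    (hm : AEStronglyMeasurable c m) (hc : ∀ x, |c x| ≤ C) {u : α → F} (hu : MemLp u p m) :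
    MemLp (c • u) p m :=
  hu.smul (memLp_top_of_bound hm C (ae_of_all _ hc))

variable [InnerProductSpace ℝ F]

theorem inner_toLp {u v : α → F} (hu : MemLp u 2 m) (hv : MemLp v 2 m) :
    inner ℝ (hu.toLp u) (hv.toLp v) = ∫ x, inner ℝ (u x) (v x) ∂m := by
  rw [L2.inner_def]
  refine integral_congr_ae ?_
  filter_upwards [hu.coeFn_toLp, hv.coeFn_toLp] with x hx hy
  rw [hx, hy]

theorem integrable_inner_of_memLp {u v : α → F} (hu : MemLp u 2 m) (hv : MemLp v 2 m) :
    Integrable (fun x => inner ℝ (u x) (v x)) m := by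
  refine (L2.integrable_inner (𝕜 := ℝ) (hu.toLp u) (hv.toLp v)).congr ?_
  filter_upwards [hu.coeFn_toLp, hv.coeFn_toLp] with x hx hy
  rw [hx, hy]

theorem integrable_bdd_mul_inner {u v : α → F} (hu : MemLp u 2 m) (hv : MemLp v 2 m) {f : α → ℝ}
    (hf : AEStronglyMeasurable f m) {C : ℝ} (hC : ∀ x, |f x| ≤ C) :
    Integrable (fun x => f x * inner ℝ (u x) (v x)) m :=
  (integrable_inner_of_memLp hu hv).bdd_mul hf (ae_of_all _ hC)

theorem tendsto_integral_inner {u v : ℕ → α → F} {u' v' : α → F} (hu : ∀ n, MemLp (u n) 2 m)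
    (hv : ∀ n, MemLp (v n) 2 m) (hu' : MemLp u' 2 m) (hv' : MemLp v' 2 m)
    (huu' : Tendsto (fun n => eLpNorm (u n - u') 2 m) atTop (𝓝 0))
    (hvv' : Tendsto (fun n => eLpNorm (v n - v') 2 m) atTop (𝓝 0)) :
    Tendsto (fun n => ∫ x, inner ℝ (u n x) (v n x) ∂m) atTop
      (𝓝 (∫ x, inner ℝ (u' x) (v' x) ∂m)) := by
  simpa only [inner_toLp] using
    ((Lp.tendsto_Lp_iff_tendsto_eLpNorm'' u hu u' hu').2 huu').inner (𝕜 := ℝ)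
      ((Lp.tendsto_Lp_iff_tendsto_eLpNorm'' v hv v' hv').2 hvv')

end Lebesgue

section Multiplier

variable {E F : Type*} [NormedAddCommGroup E] [NormedSpace ℝ E] [NormedAddCommGroup F]
  [NormedSpace ℝ F]

/-- A smooth real function that is bounded together with its derivative; multiplication by such a
function preserves `H¹`. -/
structure IsSmoothMultiplier (f : E → ℝ) : Prop where
  contDiff : ContDiff ℝ ∞ f
  bounded : ∃ C, ∀ x, |f x| ≤ C
  bounded_fderiv : ∃ C, ∀ x, ‖fderiv ℝ f x‖ ≤ C

theorem IsSmoothMultiplier.differentiableAt {f : E → ℝ} (hf : IsSmoothMultiplier f) (x : E) :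
    DifferentiableAt ℝ f x :=
  hf.contDiff.contDiffAt.differentiableAt (by simp)

theorem isSmoothMultiplier_of_deriv {f : ℝ → ℝ} {C D : ℝ} (hf : ContDiff ℝ ∞ f)
    (hC : ∀ x, |f x| ≤ C) (hD : ∀ x, |deriv f x| ≤ D) : IsSmoothMultiplier f :=
  ⟨hf, ⟨C, hC⟩, ⟨D, fun x => norm_deriv_eq_norm_fderiv.symm.trans_le (hD x)⟩⟩

theorem IsSmoothMultiplier.exists_abs_deriv_le {f : ℝ → ℝ} (hf : IsSmoothMultiplier f) :
    ∃ D, ∀ x, |deriv f x| ≤ D :=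
  hf.bounded_fderiv.imp fun _ hD x => norm_deriv_eq_norm_fderiv.trans_le (hD x)

theorem IsSmoothMultiplier.comp_continuousLinearMap {f : F → ℝ} (hf : IsSmoothMultiplier f)
    (A : E →L[ℝ] F) : IsSmoothMultiplier (f ∘ A) where
  contDiff := hf.contDiff.comp A.contDiff
  bounded := hf.bounded.imp fun _ hC x => hC (A x)
  bounded_fderiv := by
    obtain ⟨C, hC⟩ := hf.bounded_fderiv
    refine ⟨C * ‖A‖, fun x => ?_⟩
    rw [fderiv_comp x (hf.differentiableAt _) A.differentiableAt, A.fderiv]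
    exact (ContinuousLinearMap.opNorm_comp_le _ _).trans (by gcongr; exact hC _)

theorem IsSmoothMultiplier.comp_apply {ι : Type*} [Fintype ι] {f : ℝ → ℝ}
    (hf : IsSmoothMultiplier f) (k : ι) : IsSmoothMultiplier fun x : ι → ℝ => f (x k) :=
  hf.comp_continuousLinearMap (ContinuousLinearMap.proj (R := ℝ) (φ := fun _ : ι => ℝ) k)

theorem IsSmoothMultiplier.memLp_smul [MeasurableSpace E] [OpensMeasurableSpace E]
    [SecondCountableTopology E] {m : Measure E} {χ : E → ℝ} (hχ : IsSmoothMultiplier χ) {Φ : E → F}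
    {p : ENNReal} (hΦ : MemLp Φ p m) : MemLp (χ • Φ) p m :=
  let ⟨_, hC⟩ := hχ.bounded
  memLp_bdd_smul hχ.contDiff.continuous.aestronglyMeasurable hC hΦ

theorem fderiv_comp_apply_single {ι : Type*} [Finite ι] [DecidableEq ι] {f : ℝ → ℝ} {k : ι}
    {x : ι → ℝ} (hf : DifferentiableAt ℝ f (x k)) (i : ι) :
    fderiv ℝ (fun y : ι → ℝ => f (y k)) x (Pi.single i 1)
      = if i = k then deriv f (x k) else 0 := by
  cases nonempty_fintype ι
  have h : HasFDerivAt (fun y : ι → ℝ => f (y k))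
      (deriv f (x k) • ContinuousLinearMap.proj (R := ℝ) (φ := fun _ : ι => ℝ) k) x :=
    hf.hasDerivAt.comp_hasFDerivAt x (hasFDerivAt_apply k x)
  simp [h.fderiv, Pi.single_apply, eq_comm]

end Multiplier

section Sobolev

variable {ι : Type*} [Fintype ι] [LinearOrder ι] {Φ Ψ : (ι → ℝ) → ℂ} {g h : ι → (ι → ℝ) → ℂ}

theorem HasSobolevGradient.integrable_sq (hΦ : HasSobolevGradient Φ g) :
    Integrable fun x => ‖Φ x‖ ^ 2 :=
  hΦ.1.integrable_norm_pow two_ne_zero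

theorem HasSobolevGradient.integrable_sq_gradient (hΦ : HasSobolevGradient Φ g) (i : ι) :
    Integrable fun x => ‖g i x‖ ^ 2 :=
  (hΦ.2.1 i).integrable_norm_pow two_ne_zero

theorem aestronglyMeasurable_fderiv_single {φ : (ι → ℝ) → ℂ} (hφ : ContDiff ℝ ∞ φ) (i : ι) :
    AEStronglyMeasurable fun x => fderiv ℝ φ x (Pi.single i 1) :=
  ((hφ.continuous_fderiv (by simp)).clm_apply continuous_const).aestronglyMeasurable

theorem fderiv_smul_single {φ : (ι → ℝ) → ℂ} (hφ : ContDiff ℝ ∞ φ) {χ : (ι → ℝ) → ℝ}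
    (hχ : IsSmoothMultiplier χ) (i : ι) (x : ι → ℝ) :
    fderiv ℝ (χ • φ) x (Pi.single i 1)
      = χ x • fderiv ℝ φ x (Pi.single i 1) + fderiv ℝ χ x (Pi.single i 1) • φ x := by
  rw [fderiv_smul (hχ.differentiableAt x) (hφ.contDiffAt.differentiableAt (by simp))]
  rfl

theorem IsSmoothMultiplier.aestronglyMeasurable_partial {χ : (ι → ℝ) → ℝ}
    (hχ : IsSmoothMultiplier χ) (i : ι) :
    AEStronglyMeasurable fun x => fderiv ℝ χ x (Pi.single i 1) :=
  ((hχ.contDiff.continuous_fderiv (by simp)).clm_apply continuous_const).aestronglyMeasurable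

theorem IsSmoothMultiplier.exists_abs_partial_le {χ : (ι → ℝ) → ℝ} (hχ : IsSmoothMultiplier χ)
    (i : ι) : ∃ D, ∀ x, |fderiv ℝ χ x (Pi.single i 1)| ≤ D := by
  obtain ⟨D, hD⟩ := hχ.bounded_fderiv
  exact ⟨D * ‖(Pi.single i 1 : ι → ℝ)‖, fun x => (fderiv ℝ χ x).le_of_opNorm_le (hD x) _⟩

theorem HasSobolevGradient.smul (hΦ : HasSobolevGradient Φ g) {χ : (ι → ℝ) → ℝ}
    (hχ : IsSmoothMultiplier χ) :
    HasSobolevGradient (χ • Φ) fun i => χ • g i + (fderiv ℝ χ · (Pi.single i 1)) • Φ := by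
  obtain ⟨hΦL, hgL, φ, hφ, hφΦ, hφg⟩ := hΦ
  obtain ⟨C, hC⟩ := hχ.bounded
  choose D hD using hχ.exists_abs_partial_le
  have hχm := hχ.contDiff.continuous.aestronglyMeasurable (μ := volume)
  have hφm (n : ℕ) := (hφ n).1.continuous.aestronglyMeasurable (μ := volume)
  refine ⟨hχ.memLp_smul hΦL, fun i => (hχ.memLp_smul (hgL i)).add
    (memLp_bdd_smul (hχ.aestronglyMeasurable_partial i) (hD i) hΦL), fun n => χ • φ n,
    fun n => ⟨hχ.contDiff.smul (hφ n).1, (hφ n).2.smul_left⟩, ?_, fun i => ?_⟩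
  · refine (tendsto_eLpNorm_bdd_smul hC hφΦ).congr fun n => ?_
    exact congrArg (eLpNorm · 2 volume) (funext fun x => smul_sub (χ x) (φ n x) (Φ x))
  · refine (tendsto_eLpNorm_add one_le_two
      (fun n => hχm.smul ((aestronglyMeasurable_fderiv_single (hφ n).1 i).sub (hgL i).1))
      (fun n => (hχ.aestronglyMeasurable_partial i).smul ((hφm n).sub hΦL.1))
      (tendsto_eLpNorm_bdd_smul hC (hφg i)) (tendsto_eLpNorm_bdd_smul (hD i) hφΦ)).congr fun n => ?_
    congr 1
    funext x
    simp only [fderiv_smul_single (hφ n).1 hχ, Pi.add_apply, Pi.smul_apply', smul_sub,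
      Pi.sub_apply]
    abel

theorem HasSobolevGradient.smul_coord (hΦ : HasSobolevGradient Φ g) {f : ℝ → ℝ}
    (hf : IsSmoothMultiplier f) (k : ι) :
    HasSobolevGradient (fun x => f (x k) • Φ x)
      fun i x => f (x k) • g i x + (if i = k then deriv f (x k) else 0) • Φ x := by
  have h := hΦ.smul (hf.comp_apply k)
  simp only [fderiv_comp_apply_single (hf.differentiableAt _)] at h
  exact h

theorem integral_inner_fderiv_eq_neg {φ ψ : (ι → ℝ) → ℂ} (hφ : ContDiff ℝ ∞ φ)
    (hφc : HasCompactSupport φ) (hψ : ContDiff ℝ ∞ ψ) (k : ι) :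
    ∫ x, inner ℝ (φ x) (fderiv ℝ ψ x (Pi.single k 1))
      = -∫ x, inner ℝ (fderiv ℝ φ x (Pi.single k 1)) (ψ x) := by
  have hdφ : Continuous fun x => fderiv ℝ φ x (Pi.single k 1) :=
    (hφ.continuous_fderiv (by simp)).clm_apply continuous_const
  have hdψ : Continuous fun x => fderiv ℝ ψ x (Pi.single k 1) :=
    (hψ.continuous_fderiv (by simp)).clm_apply continuous_const
  have hdφc : HasCompactSupport fun x => fderiv ℝ φ x (Pi.single k 1) :=
    hφc.fderiv_apply (𝕜 := ℝ) _
  have hint {u v : (ι → ℝ) → ℂ} (hu : Continuous u) (huc : HasCompactSupport u)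
      (hv : Continuous v) : Integrable fun x => innerSL ℝ (u x) (v x) :=
    (hu.inner hv).integrable_of_hasCompactSupport (huc.mono fun x hx h0 => hx (by simp [h0]))
  exact integral_bilinear_fderiv_right_eq_neg_left_of_integrable (B := innerSL ℝ)
    (hint hdφ hdφc hψ.continuous) (hint hφ.continuous hφc hdψ)
    (hint hφ.continuous hφc hψ.continuous)
    (fun x _ => hφ.contDiffAt.differentiableAt (by simp))
    fun x _ => hψ.contDiffAt.differentiableAt (by simp)

theorem HasSobolevGradient.integral_inner_gradient (hΦ : HasSobolevGradient Φ g)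
    (hΨ : HasSobolevGradient Ψ h) (k : ι) :
    ∫ x, inner ℝ (Φ x) (h k x) = -∫ x, inner ℝ (g k x) (Ψ x) := by
  obtain ⟨hΦL, hgL, φ, hφ, hφΦ, hφg⟩ := hΦ
  obtain ⟨hΨL, hhL, ψ, hψ, hψΨ, hψh⟩ := hΨ
  have hL {χ : (ι → ℝ) → ℂ} (hχ : ContDiff ℝ ∞ χ ∧ HasCompactSupport χ) : MemLp χ 2 :=
    hχ.1.continuous.memLp_of_hasCompactSupport hχ.2
  have hdL {χ : (ι → ℝ) → ℂ} (hχ : ContDiff ℝ ∞ χ ∧ HasCompactSupport χ) :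
      MemLp (fun x => fderiv ℝ χ x (Pi.single k 1)) 2 :=
    ((hχ.1.continuous_fderiv (by simp)).clm_apply continuous_const).memLp_of_hasCompactSupport
      (hχ.2.fderiv_apply (𝕜 := ℝ) _)
  have hlim := tendsto_integral_inner (fun n => hL (hφ n)) (fun n => hdL (hψ n)) hΦL (hhL k)
    hφΦ (hψh k)
  have hlim' := tendsto_integral_inner (fun n => hdL (hφ n)) (fun n => hL (hψ n)) (hgL k) hΨL
    (hφg k) hψΨ
  refine tendsto_nhds_unique (hlim.congr fun n => ?_) hlim'.neg
  exact integral_inner_fderiv_eq_neg (hφ n).1 (hφ n).2 (hψ n).1 k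

theorem HasSobolevGradient.integral_deriv_mul_sq (hΦ : HasSobolevGradient Φ g) {f : ℝ → ℝ}
    (hf : IsSmoothMultiplier f) (k : ι) :
    ∫ x, deriv f (x k) * ‖Φ x‖ ^ 2 = -(2 * ∫ x, f (x k) * inner ℝ (Φ x) (g k x)) := by
  obtain ⟨C, hC⟩ := hf.bounded
  have hfm : Measurable fun x : ι → ℝ => f (x k) :=
    hf.contDiff.continuous.measurable.comp (measurable_pi_apply k)
  have hint : Integrable fun x => f (x k) * inner ℝ (Φ x) (g k x) :=
    integrable_bdd_mul_inner hΦ.1 (hΦ.2.1 k) hfm.aestronglyMeasurable fun x => hC _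
  have hint' : Integrable fun x => deriv f (x k) * ‖Φ x‖ ^ 2 := by
    obtain ⟨D, hD⟩ := hf.exists_abs_deriv_le
    exact integrable_bdd_mul_sq hΦ.1
      ((measurable_deriv f).comp (measurable_pi_apply k)).aestronglyMeasurable fun x => hD _
  have hibp := hΦ.integral_inner_gradient (hΦ.smul_coord hf k) k
  simp only [if_true, inner_add_right, real_inner_smul_right, real_inner_self_eq_norm_sq,
    real_inner_comm (Φ _) (g k _)] at hibp
  rw [integral_add hint hint'] at hibp
  linarith

end Sobolev

section Energy

variable {ι : Type*} [Fintype ι]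

/-- The energy `⟨Φ, (-c Δ + U) Φ⟩` of a function `Φ` with weak partial derivatives `g i`. -/
noncomputable def energy (c : ℝ) (U : (ι → ℝ) → ℝ) (Φ : (ι → ℝ) → ℂ) (g : ι → (ι → ℝ) → ℂ) : ℝ :=
  c * (∑ i, ∫ x, ‖g i x‖ ^ 2) + ∫ x, U x * ‖Φ x‖ ^ 2

theorem norm_smul_sq {F : Type*} [NormedAddCommGroup F] [NormedSpace ℝ F] (a : ℝ) (v : F) :
    ‖a • v‖ ^ 2 = a ^ 2 * ‖v‖ ^ 2 := by
  rw [norm_smul, mul_pow, Real.norm_eq_abs, sq_abs]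

theorem energy_const_smul (c : ℝ) (U : (ι → ℝ) → ℝ) (Φ : (ι → ℝ) → ℂ) (g : ι → (ι → ℝ) → ℂ)
    (a : ℝ) : energy c U (fun x => a • Φ x) (fun i x => a • g i x) = a ^ 2 * energy c U Φ g := by
  simp only [energy, norm_smul_sq, mul_left_comm (U _), integral_const_mul, ← Finset.mul_sum]
  ring

/-- The form domain of `-c Δ + U`: the `H¹` functions of finite potential energy. -/
structure InFormDomain [LinearOrder ι] (U : (ι → ℝ) → ℝ) (Φ : (ι → ℝ) → ℂ)
    (g : ι → (ι → ℝ) → ℂ) : Prop where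
  sobolev : HasSobolevGradient Φ g
  integrable : Integrable fun x => U x * ‖Φ x‖ ^ 2

/-- The operator inequality `-c Δ + U ≥ E`, in the sense of quadratic forms. -/
def EnergyBoundedBelow [LinearOrder ι] (c : ℝ) (U : (ι → ℝ) → ℝ) (E : ℝ) : Prop :=
  ∀ Φ g, InFormDomain U Φ g → E * ∫ x, ‖Φ x‖ ^ 2 ≤ energy c U Φ g

end Energy

theorem exists_seq_tendsto_eLpNorm_ae_section {α β κ F : Type*} [MeasurableSpace α]
    [MeasurableSpace β] {m : Measure α} {m' : Measure β} [SFinite m'] [NormedAddCommGroup F]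
    [Finite κ] {v : κ → ℕ → α × β → F} (hvm : ∀ i n, AEStronglyMeasurable (v i n) (m.prod m'))
    (hv : ∀ i, Tendsto (fun n => eLpNorm (v i n) 2 (m.prod m')) atTop (𝓝 0)) :
    ∃ ns : ℕ → ℕ, ∀ᵐ a ∂m, ∀ i,
      Tendsto (fun n => eLpNorm (fun b => v i (ns n) (a, b)) 2 m') atTop (𝓝 0) := by
  cases nonempty_fintype κ
  have hm (i : κ) (n : ℕ) : AEMeasurable (fun z => ‖v i n z‖ₑ ^ 2) (m.prod m') :=
    (hvm i n).enorm.pow_const 2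
  have hsum (n : ℕ) : ∫⁻ a, ∑ i, ∫⁻ b, ‖v i n (a, b)‖ₑ ^ 2 ∂m' ∂m
      = ∑ i, ∫⁻ z, ‖v i n z‖ₑ ^ 2 ∂m.prod m' := by
    rw [lintegral_finsetSum' _ fun i _ => (hm i n).lintegral_prod_right']
    exact Finset.sum_congr rfl fun i _ => (lintegral_prod _ (hm i n)).symm
  have hlim : Tendsto (fun n => ∫⁻ a, ∑ i, ∫⁻ b, ‖v i n (a, b)‖ₑ ^ 2 ∂m' ∂m) atTop (𝓝 0) := by
    simp only [hsum]
    simpa using tendsto_finsetSum Finset.univ fun i _ => tendsto_eLpNorm_two_iff.1 (hv i)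
  obtain ⟨ns, hns⟩ := exists_seq_tendsto_zero_ae_of_lintegral
    (fun n => Finset.aemeasurable_fun_sum _ fun i _ => (hm i n).lintegral_prod_right') hlim
  refine ⟨ns, hns.mono fun a ha i => tendsto_eLpNorm_two_iff.2 ?_⟩
  exact tendsto_of_tendsto_of_tendsto_of_le_of_le tendsto_const_nhds ha (fun _ => zero_le)
    fun n => Finset.single_le_sum (f := fun i => ∫⁻ b, ‖v i (ns n) (a, b)‖ₑ ^ 2 ∂m')
      (fun _ _ => zero_le) (Finset.mem_univ i)

section Slice

variable {ι : Type*} (p : ι → Prop) [DecidablePred p]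

/-- The point with coordinates `z.1` at the indices satisfying `p` and `z.2` at the others;
slicing fixes `z.1`. -/
def joinCoord : ({i // p i} → ℝ) × ({i // ¬p i} → ℝ) ≃ᵐ (ι → ℝ) :=
  (MeasurableEquiv.piEquivPiSubtypeProd (fun _ => ℝ) p).symm

theorem joinCoord_apply (t : {i // p i} → ℝ) (y : {i // ¬p i} → ℝ) (i : ι) :
    joinCoord p (t, y) i = if h : p i then t ⟨i, h⟩ else y ⟨i, h⟩ :=
  rfl

theorem joinCoord_subtype (t : {i // p i} → ℝ) (y : {i // ¬p i} → ℝ) (j : {i // ¬p i}) :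
    joinCoord p (t, y) j = y j := by
  simp [joinCoord_apply, j.2]

theorem hasCompactSupport_comp_joinCoord (t : {i // p i} → ℝ) {φ : (ι → ℝ) → ℂ}
    (hφ : HasCompactSupport φ) : HasCompactSupport fun y => φ (joinCoord p (t, y)) := by
  have hc : Continuous fun (x : ι → ℝ) (j : {i // ¬p i}) => x j := by fun_prop
  refine HasCompactSupport.intro (hφ.isCompact.image hc) fun y hy => ?_
  refine image_eq_zero_of_notMem_tsupport fun hmem => hy ⟨_, hmem, ?_⟩
  exact funext (joinCoord_subtype p t y)

theorem hasFDerivAt_joinCoord [Finite ι] (t : {i // p i} → ℝ) (y : {i // ¬p i} → ℝ) :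
    HasFDerivAt (fun y => joinCoord p (t, y))
      (ContinuousLinearMap.pi fun i : ι => if h : p i then (0 : ({i // ¬p i} → ℝ) →L[ℝ] ℝ)
        else ContinuousLinearMap.proj ⟨i, h⟩) y := by
  cases nonempty_fintype ι
  refine hasFDerivAt_pi.2 fun i => ?_
  by_cases h : p i
  · simp only [joinCoord_apply, dif_pos h]
    exact hasFDerivAt_const _ _
  · simp only [joinCoord_apply, dif_neg h]
    exact hasFDerivAt_apply _ _

theorem fderiv_comp_joinCoord [Finite ι] [DecidableEq ι] {_ : DecidableEq {i // ¬p i}}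
    (t : {i // p i} → ℝ) (y : {i // ¬p i} → ℝ) {φ : (ι → ℝ) → ℂ} (hφ : Differentiable ℝ φ)
    (j : {i // ¬p i}) :
    fderiv ℝ (fun y => φ (joinCoord p (t, y))) y (Pi.single j 1) =
      fderiv ℝ φ (joinCoord p (t, y)) (Pi.single (j : ι) 1) := by
  cases nonempty_fintype ι
  have h := (hφ (joinCoord p (t, y))).hasFDerivAt.comp y (hasFDerivAt_joinCoord p t y)
  refine (congrFun (congrArg DFunLike.coe h.fderiv) _).trans ?_
  rw [ContinuousLinearMap.comp_apply]
  congr 1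
  funext i
  by_cases hi : p i
  · have hij : i ≠ j := fun h => j.2 (h ▸ hi)
    simp [hi, hij]
  · simp [hi, Pi.single_apply, Subtype.ext_iff]

variable [Fintype ι]

theorem measurePreserving_joinCoord :
    MeasurePreserving (joinCoord p) (volume.prod volume) volume :=
  (volume_preserving_piEquivPiSubtypeProd (fun _ => ℝ) p).symm

theorem contDiff_joinCoord (t : {i // p i} → ℝ) : ContDiff ℝ ∞ fun y => joinCoord p (t, y) := by
  refine contDiff_pi.2 fun i => ?_
  by_cases h : p i
  · simp only [joinCoord_apply, dif_pos h]
    exact contDiff_const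
  · simp only [joinCoord_apply, dif_neg h]
    exact contDiff_apply ℝ ℝ _

variable {p}

theorem memLp_slice {u : (ι → ℝ) → ℂ} (hu : MemLp u 2) :
    ∀ᵐ t, MemLp (fun y => u (joinCoord p (t, y))) 2 := by
  have hmp := hu.comp_measurePreserving (measurePreserving_joinCoord p)
  filter_upwards [hmp.1.prodMk_left, (hmp.integrable_norm_pow two_ne_zero).prod_right_ae]
    with t ht ht'
  exact (memLp_two_iff_integrable_sq_norm ht).2 ht'

theorem integrable_slice {u : (ι → ℝ) → ℝ} (hu : Integrable u) :
    ∀ᵐ t, Integrable fun y => u (joinCoord p (t, y)) :=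
  ((measurePreserving_joinCoord p).integrable_comp_of_integrable hu).prod_right_ae

theorem integral_slice {u : (ι → ℝ) → ℝ} (hu : Integrable u) :
    ∫ x, u x = ∫ t, ∫ y, u (joinCoord p (t, y)) := by
  rw [← (measurePreserving_joinCoord p).integral_comp (joinCoord p).measurableEmbedding]
  exact integral_prod _ ((measurePreserving_joinCoord p).integrable_comp_of_integrable hu)

variable [LinearOrder ι] {Φ : (ι → ℝ) → ℂ} {g : ι → (ι → ℝ) → ℂ}

theorem HasSobolevGradient.slice (hΦ : HasSobolevGradient Φ g) :
    ∀ᵐ t, HasSobolevGradient (fun y => Φ (joinCoord p (t, y)))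
      fun (j : {i // ¬p i}) y => g j (joinCoord p (t, y)) := by
  obtain ⟨hΦL, hgL, φ, hφ, hφΦ, hφg⟩ := hΦ
  let v : Option ι → ℕ → (ι → ℝ) → ℂ := fun i n => match i with
    | none => fun x => φ n x - Φ x
    | some i => fun x => fderiv ℝ (φ n) x (Pi.single i 1) - g i x
  have hvm : ∀ i n, AEStronglyMeasurable (v i n) := fun i n => match i with
    | none => (hφ n).1.continuous.aestronglyMeasurable.sub hΦL.1
    | some i => (aestronglyMeasurable_fderiv_single (hφ n).1 i).sub (hgL i).1
  have hv : ∀ i, Tendsto (fun n => eLpNorm (v i n) 2) atTop (𝓝 0) := fun i => match i with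
    | none => hφΦ
    | some i => hφg i
  have hmp := measurePreserving_joinCoord p
  obtain ⟨ns, hns⟩ := exists_seq_tendsto_eLpNorm_ae_section
    (fun i n => (hvm i n).comp_measurePreserving hmp)
    (fun i => (hv i).congr fun n => (eLpNorm_comp_measurePreserving (hvm i n) hmp).symm)
  filter_upwards [hns, memLp_slice hΦL, eventually_all.2 fun i => memLp_slice (hgL i)]
    with t ht hΦt hgt
  refine ⟨hΦt, fun j => hgt j, fun n y => φ (ns n) (joinCoord p (t, y)),
    fun n => ⟨(hφ (ns n)).1.comp (contDiff_joinCoord p t),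
      hasCompactSupport_comp_joinCoord p t (hφ (ns n)).2⟩, ht none, fun j => ?_⟩
  simp only [fderiv_comp_joinCoord p t _ ((hφ _).1.differentiable (by simp))]
  exact ht (some j)

theorem EnergyBoundedBelow.le_integral_slice {c E : ℝ} {U : ({i // ¬p i} → ℝ) → ℝ}
    (hU : EnergyBoundedBelow c U E) (hΦ : HasSobolevGradient Φ g)
    (hint : Integrable fun x => U (fun j => x j) * ‖Φ x‖ ^ 2) :
    E * ∫ x, ‖Φ x‖ ^ 2 ≤
      c * (∑ i : {i // ¬p i}, ∫ x, ‖g i x‖ ^ 2) + ∫ x, U (fun j => x j) * ‖Φ x‖ ^ 2 := by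
  have hkin : Integrable fun x => c * ∑ i : {i // ¬p i}, ‖g i x‖ ^ 2 :=
    (integrable_finsetSum _ fun (i : {i // ¬p i}) _ => hΦ.integrable_sq_gradient i).const_mul c
  have hslice : ∫ x, E * ‖Φ x‖ ^ 2 ≤
      ∫ x, (c * (∑ i : {i // ¬p i}, ‖g i x‖ ^ 2) + U (fun j => x j) * ‖Φ x‖ ^ 2) := by
    have hL := hΦ.integrable_sq.const_mul E
    have hR : Integrable fun x =>
        c * (∑ i : {i // ¬p i}, ‖g i x‖ ^ 2) + U (fun j => x j) * ‖Φ x‖ ^ 2 := hkin.add hint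
    rw [integral_slice (p := p) hL, integral_slice (p := p) hR]
    have hmp := measurePreserving_joinCoord p
    refine integral_mono_ae (hmp.integrable_comp_of_integrable hL).integral_prod_left
      (hmp.integrable_comp_of_integrable hR).integral_prod_left ?_
    filter_upwards [hΦ.slice (p := p), integrable_slice hint] with t ht hit
    simp only [joinCoord_subtype] at hit ⊢
    have hg (i : {i // ¬p i}) := ht.integrable_sq_gradient i
    refine (integral_const_mul _ _).trans_le ((hU _ _ ⟨ht, hit⟩).trans_eq ?_)
    rw [integral_add ((integrable_finsetSum _ fun i _ => hg i).const_mul c) hit,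
      integral_const_mul, integral_finsetSum _ fun i _ => hg i]
    rfl
  rwa [integral_const_mul, integral_add hkin hint, integral_const_mul,
    integral_finsetSum _ fun (i : {i // ¬p i}) _ => hΦ.integrable_sq_gradient i] at hslice

end Slice

theorem integrable_mul_of_add_of_bddBelow {α : Type*} [MeasurableSpace α] {m : Measure α}
    {f g ρ : α → ℝ} {C D : ℝ} (hf : AEStronglyMeasurable f m) (hρ : Integrable ρ m)
    (hρ0 : ∀ x, 0 ≤ ρ x) (hfg : Integrable (fun x => (f x + g x) * ρ x) m)
    (hC : ∀ x, -C ≤ f x) (hD : ∀ x, -D ≤ g x) : Integrable (fun x => f x * ρ x) m := by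
  have hshift : Integrable (fun x => (f x + C) * ρ x) m := by
    refine (hfg.add (hρ.const_mul (C + D))).mono' ((hf.add_const C).mul hρ.1)
      (ae_of_all _ fun x => ?_)
    rw [Real.norm_of_nonneg (mul_nonneg (by linarith [hC x]) (hρ0 x)), Pi.add_apply, ← add_mul]
    exact mul_le_mul_of_nonneg_right (by linarith [hD x]) (hρ0 x)
  refine (hshift.sub (hρ.const_mul C)).congr (ae_of_all _ fun x => ?_)
  simp only [Pi.sub_apply]
  ring

section Potential

variable {ι : Type*} [LinearOrder ι]

/-- The interaction `W_{jl}(x_j - x_l)` if `j < l`, and `0` otherwise. -/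
noncomputable def pairPotential (W : ι → ι → ℝ → ℝ) (j l : ι) (x : ι → ℝ) : ℝ :=
  if j < l then W j l (x j - x l) else 0

/-- Measurable potentials whose attraction is dominated by `3 / √(x² + s)` and whose repulsion is
nonnegative and, off the diagonal, dominates `1 / √(x² + 4 s)`. The factor `4` is the one for which
`√((x - y)² + 4 s) ≤ √(x² + s) + √(y² + s)`. -/
structure CoulombBounds (s : ℝ) (V : ι → ℝ → ℝ) (W : ι → ι → ℝ → ℝ) : Prop where
  one_le : 1 ≤ s
  measurable_attraction : ∀ j, Measurable (V j)
  measurable_repulsion : ∀ j k, j < k → Measurable (W j k)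
  attraction_le : ∀ j x, V j x ≤ 3 / softAbs s x
  repulsion_nonneg : ∀ j k, j < k → ∀ x, 0 ≤ W j k x
  le_repulsion : ∀ j k, j < k → ∀ x, x ≠ 0 → 1 / softAbs (4 * s) x ≤ W j k x

variable {s Z : ℝ} {V : ι → ℝ → ℝ} {W : ι → ι → ℝ → ℝ}

theorem PotentialBounds.coulombBounds {μ ν : ℕ} (h : PotentialBounds μ ν V W)
    (hνμ : ν ≤ 2 * (μ + 1)) : CoulombBounds ((μ : ℝ) + 1) V W where
  one_le := by simp
  measurable_attraction := h.1
  measurable_repulsion := h.2.1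
  attraction_le j x := (h.2.2.1 j x).trans (regCoulomb_le μ x)
  repulsion_nonneg j k hjk x :=
    (one_div_nonneg.2 (Real.sqrt_nonneg _)).trans
      ((le_regCoulombPred_div_sqrt_two ν x).trans (h.2.2.2 j k hjk x))
  le_repulsion j k hjk x hx := by
    refine le_trans ?_ ((le_regCoulombPred_div_sqrt_two ν x).trans (h.2.2.2 j k hjk x))
    have hν : (ν : ℝ) ≤ 2 * (μ + 1) := by exact_mod_cast hνμ
    refine one_div_le_one_div_of_le (Real.sqrt_pos.2 (by positivity)) (Real.sqrt_le_sqrt ?_)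
    linarith

namespace CoulombBounds

theorem remove (h : CoulombBounds s V W) (k : ι) :
    CoulombBounds (ι := {j // j ≠ k}) s (fun j => V j) (fun i j => W i j) where
  one_le := h.one_le
  measurable_attraction j := h.measurable_attraction j
  measurable_repulsion i j := h.measurable_repulsion i j
  attraction_le j := h.attraction_le j
  repulsion_nonneg i j := h.repulsion_nonneg i j
  le_repulsion i j := h.le_repulsion i j

theorem attraction_le_mul_one_div_softAbs (h : CoulombBounds s V W) (j : ι) (x : ℝ) :
    V j x ≤ 3 * (1 / softAbs 1 x) := by
  have hanti := one_div_softAbs_anti one_pos h.one_le x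
  have hV := h.attraction_le j x
  rw [div_eq_mul_one_div] at hV
  linarith

theorem attraction_le_three (h : CoulombBounds s V W) (j : ι) (x : ℝ) : V j x ≤ 3 := by
  linarith [h.attraction_le_mul_one_div_softAbs j x, one_div_softAbs_le_one le_rfl x]

theorem neg_three_mul_le_attraction (h : CoulombBounds s V W) (hZ : 0 ≤ Z) (j : ι) (x : ℝ) :
    -(3 * Z) ≤ -Z * V j x := by
  nlinarith [h.attraction_le_three j x]

theorem pairPotential_nonneg (h : CoulombBounds s V W) (j l : ι) (x : ι → ℝ) :
    0 ≤ pairPotential W j l x := by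
  unfold pairPotential
  split_ifs with hjl
  exacts [h.repulsion_nonneg j l hjl _, le_rfl]

theorem measurable_pairPotential (h : CoulombBounds s V W) (j l : ι) :
    Measurable (pairPotential W j l) := by
  unfold pairPotential
  split_ifs with hjl
  exacts [(h.measurable_repulsion j l hjl).comp (by fun_prop), measurable_const]

end CoulombBounds

variable [Fintype ι]

/-- The interaction of particle `k` with all the others. -/
noncomputable def interactionWith (W : ι → ι → ℝ → ℝ) (k : ι) (x : ι → ℝ) : ℝ :=
  ∑ j, (pairPotential W k j x + pairPotential W j k x)

/-- The total potential of the system from which particle `k` has been removed. -/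
noncomputable def totalPotentialRemove (Z : ℝ) (V : ι → ℝ → ℝ) (W : ι → ι → ℝ → ℝ) (k : ι) :
    ({j // j ≠ k} → ℝ) → ℝ :=
  totalPotential Z (fun j : {j // j ≠ k} => V j) (fun i j => W i j)

theorem totalPotential_eq_sum_pairPotential (Z : ℝ) (V : ι → ℝ → ℝ) (W : ι → ι → ℝ → ℝ)
    (x : ι → ℝ) :
    totalPotential Z V W x = -Z * ∑ j, V j (x j) + ∑ j, ∑ l, pairPotential W j l x := by
  simp only [totalPotential, pairPotential, Finset.sum_filter]

theorem totalPotential_eq_remove_add (Z : ℝ) (V : ι → ℝ → ℝ) (W : ι → ι → ℝ → ℝ) (k : ι)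
    (x : ι → ℝ) :
    totalPotential Z V W x
      = totalPotentialRemove Z V W k (fun j => x j) + -Z * V k (x k) + interactionWith W k x := by
  have hsub (i j : {j // j ≠ k}) : pairPotential (fun i j : {j // j ≠ k} => W i j) i j
      (fun j => x j) = pairPotential W i j x := by
    simp [pairPotential]
  have hkk : pairPotential W k k x = 0 := by simp [pairPotential]
  simp only [totalPotentialRemove, totalPotential_eq_sum_pairPotential, hsub, interactionWith,
    Fintype.sum_eq_add_sum_subtype_ne _ k, Finset.sum_add_distrib, hkk]
  ring

namespace CoulombBounds

theorem interactionWith_nonneg (h : CoulombBounds s V W) (k : ι) (x : ι → ℝ) :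
    0 ≤ interactionWith W k x :=
  Finset.sum_nonneg fun _ _ =>
    add_nonneg (h.pairPotential_nonneg _ _ _) (h.pairPotential_nonneg _ _ _)

theorem measurable_interactionWith (h : CoulombBounds s V W) (k : ι) :
    Measurable (interactionWith W k) :=
  Finset.measurable_fun_sum _ fun _ _ =>
    (h.measurable_pairPotential _ _).add (h.measurable_pairPotential _ _)

theorem neg_three_mul_card_le_totalPotential (h : CoulombBounds s V W) (hZ : 0 ≤ Z) (x : ι → ℝ) :
    -(3 * Z * Fintype.card ι) ≤ totalPotential Z V W x := by
  have hatt : ∑ _j : ι, -(3 * Z) ≤ ∑ j, -Z * V j (x j) :=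
    Finset.sum_le_sum fun j _ => h.neg_three_mul_le_attraction hZ j (x j)
  have hrep : 0 ≤ ∑ j, ∑ l, pairPotential W j l x :=
    Finset.sum_nonneg fun _ _ => Finset.sum_nonneg fun _ _ => h.pairPotential_nonneg _ _ _
  rw [totalPotential_eq_sum_pairPotential, Finset.mul_sum]
  simp only [Finset.sum_const, Finset.card_univ, nsmul_eq_mul] at hatt
  linarith

theorem neg_three_mul_card_le_totalPotentialRemove (h : CoulombBounds s V W) (hZ : 0 ≤ Z) (k : ι)
    (y : {j // j ≠ k} → ℝ) :
    -(3 * Z * Fintype.card {j // j ≠ k}) ≤ totalPotentialRemove Z V W k y :=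
  (h.remove k).neg_three_mul_card_le_totalPotential hZ y

variable {Φ : (ι → ℝ) → ℂ} {g : ι → (ι → ℝ) → ℂ}

theorem integrable_interactionWith (h : CoulombBounds s V W) (hZ : 0 ≤ Z)
    (hΦ : InFormDomain (totalPotential Z V W) Φ g) (k : ι) :
    Integrable fun x => interactionWith W k x * ‖Φ x‖ ^ 2 := by
  refine integrable_mul_of_add_of_bddBelow (C := 0) (D := 3 * Z * Fintype.card {j // j ≠ k} + 3 * Z)
    (g := fun x => totalPotentialRemove Z V W k (fun j => x j) + -Z * V k (x k))
    (h.measurable_interactionWith k).aestronglyMeasurable hΦ.sobolev.integrable_sq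
    (fun x => sq_nonneg _) (hΦ.integrable.congr (ae_of_all _ fun x => ?_))
    (fun x => by simpa using h.interactionWith_nonneg k x) fun x => ?_
  · simp only [totalPotential_eq_remove_add Z V W k x]
    ring
  · linarith [h.neg_three_mul_card_le_totalPotentialRemove hZ k fun j => x j,
      h.neg_three_mul_le_attraction hZ k (x k)]

theorem integrable_attraction (h : CoulombBounds s V W) (hZ : 0 ≤ Z)
    (hΦ : InFormDomain (totalPotential Z V W) Φ g) (k : ι) :
    Integrable fun x => -Z * V k (x k) * ‖Φ x‖ ^ 2 := by
  refine integrable_mul_of_add_of_bddBelow (C := 3 * Z) (D := 3 * Z * Fintype.card {j // j ≠ k})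
    (g := fun x => totalPotentialRemove Z V W k (fun j => x j) + interactionWith W k x)
    (((h.measurable_attraction k).comp (measurable_pi_apply k)).const_mul _).aestronglyMeasurable
    hΦ.sobolev.integrable_sq (fun x => sq_nonneg _)
    (hΦ.integrable.congr (ae_of_all _ fun x => ?_))
    (fun x => h.neg_three_mul_le_attraction hZ k (x k)) fun x => ?_
  · simp only [totalPotential_eq_remove_add Z V W k x]
    ring
  · linarith [h.neg_three_mul_card_le_totalPotentialRemove hZ k fun j => x j,
      h.interactionWith_nonneg k x]

theorem integrable_totalPotentialRemove (h : CoulombBounds s V W) (hZ : 0 ≤ Z)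
    (hΦ : InFormDomain (totalPotential Z V W) Φ g) (k : ι) :
    Integrable fun x => totalPotentialRemove Z V W k (fun j => x j) * ‖Φ x‖ ^ 2 := by
  refine ((hΦ.integrable.sub (h.integrable_attraction hZ hΦ k)).sub
    (h.integrable_interactionWith hZ hΦ k)).congr (ae_of_all _ fun x => ?_)
  simp only [Pi.sub_apply, totalPotential_eq_remove_add Z V W k x]
  ring

end CoulombBounds

end Potential

section Localization

theorem norm_sq_smul_add_smul_add_norm_sq {F : Type*} [NormedAddCommGroup F]
    [InnerProductSpace ℝ F] {a b a' b' : ℝ} (hab : a ^ 2 + b ^ 2 = 1) (h : a * a' + b * b' = 0)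
    (u v : F) : ‖a • u + a' • v‖ ^ 2 + ‖b • u + b' • v‖ ^ 2
      = ‖u‖ ^ 2 + (a' ^ 2 + b' ^ 2) * ‖v‖ ^ 2 := by
  simp only [norm_add_sq_real, norm_smul, mul_pow, Real.norm_eq_abs, sq_abs, real_inner_smul_left,
    real_inner_smul_right]
  linear_combination ‖u‖ ^ 2 * hab + 2 * inner ℝ u v * h

theorem mul_deriv_add_mul_deriv_eq_zero {f₁ f₂ : ℝ → ℝ} (hf : ∀ t, f₁ t ^ 2 + f₂ t ^ 2 = 1)
    (h₁ : Differentiable ℝ f₁) (h₂ : Differentiable ℝ f₂) (t : ℝ) :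
    f₁ t * deriv f₁ t + f₂ t * deriv f₂ t = 0 := by
  have hd := ((h₁ t).hasDerivAt.pow 2).add ((h₂ t).hasDerivAt.pow 2)
  have hconst : HasDerivAt (f₁ ^ 2 + f₂ ^ 2) 0 t := by
    simpa only [show f₁ ^ 2 + f₂ ^ 2 = fun _ => 1 from funext hf] using hasDerivAt_const t (1 : ℝ)
  have hzero := hd.unique hconst
  simp only [Nat.cast_ofNat, Nat.add_one_sub_one, pow_one] at hzero
  linarith

variable {ι : Type*} [Fintype ι] [LinearOrder ι] {U : (ι → ℝ) → ℝ} {Φ : (ι → ℝ) → ℂ}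
  {g : ι → (ι → ℝ) → ℂ}

theorem InFormDomain.smul_coord (hΦ : InFormDomain U Φ g) {f : ℝ → ℝ} (hf : IsSmoothMultiplier f)
    (k : ι) : InFormDomain U (fun x => f (x k) • Φ x)
      fun i x => f (x k) • g i x + (if i = k then deriv f (x k) else 0) • Φ x where
  sobolev := hΦ.sobolev.smul_coord hf k
  integrable := by
    obtain ⟨C, hC⟩ := hf.bounded
    have hfm : AEStronglyMeasurable fun x : ι → ℝ => f (x k) ^ 2 :=
      ((hf.contDiff.continuous.measurable.comp (measurable_pi_apply k)).pow_const
        2).aestronglyMeasurable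
    refine (hΦ.integrable.bdd_mul hfm (ae_of_all _ fun x => ?_) (c := C ^ 2)).congr
      (ae_of_all _ fun x => ?_)
    · rw [norm_pow]
      exact pow_le_pow_left₀ (norm_nonneg _) (hC _) 2
    · simp only [norm_smul_sq]
      ring

theorem HasSobolevGradient.integral_sq_gradient_smul_coord_add (hΦ : HasSobolevGradient Φ g)
    {f₁ f₂ : ℝ → ℝ} (h₁ : IsSmoothMultiplier f₁) (h₂ : IsSmoothMultiplier f₂)
    (hf : ∀ t, f₁ t ^ 2 + f₂ t ^ 2 = 1) (k i : ι) :
    (∫ x, ‖f₁ (x k) • g i x + (if i = k then deriv f₁ (x k) else 0) • Φ x‖ ^ 2)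
        + ∫ x, ‖f₂ (x k) • g i x + (if i = k then deriv f₂ (x k) else 0) • Φ x‖ ^ 2
      = (∫ x, ‖g i x‖ ^ 2)
        + if i = k then ∫ x, (deriv f₁ (x k) ^ 2 + deriv f₂ (x k) ^ 2) * ‖Φ x‖ ^ 2 else 0 := by
  have hg₁ := (hΦ.smul_coord h₁ k).integrable_sq_gradient i
  have hg₂ := (hΦ.smul_coord h₂ k).integrable_sq_gradient i
  rw [← integral_add hg₁ hg₂]
  rcases eq_or_ne i k with rfl | hik
  · have hpointwise (x : ι → ℝ) := norm_sq_smul_add_smul_add_norm_sq (hf (x i))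
      (mul_deriv_add_mul_deriv_eq_zero hf h₁.differentiableAt h₂.differentiableAt (x i))
      (g i x) (Φ x)
    have herr : Integrable fun x => (deriv f₁ (x i) ^ 2 + deriv f₂ (x i) ^ 2) * ‖Φ x‖ ^ 2 := by
      refine ((hg₁.add hg₂).sub (hΦ.integrable_sq_gradient i)).congr (ae_of_all _ fun x => ?_)
      simp only [Pi.sub_apply, Pi.add_apply, if_true, hpointwise, add_sub_cancel_left]
    simp only [if_true, hpointwise, integral_add (hΦ.integrable_sq_gradient i) herr]
  · simp only [hik, if_false, zero_smul, add_zero, norm_smul_sq, ← add_mul, hf, one_mul]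

/-- The IMS localization formula. -/
theorem InFormDomain.energy_smul_coord_add (hΦ : InFormDomain U Φ g) (c : ℝ) {f₁ f₂ : ℝ → ℝ}
    (h₁ : IsSmoothMultiplier f₁) (h₂ : IsSmoothMultiplier f₂)
    (hf : ∀ t, f₁ t ^ 2 + f₂ t ^ 2 = 1) (k : ι) :
    energy c U (fun x => f₁ (x k) • Φ x)
          (fun i x => f₁ (x k) • g i x + (if i = k then deriv f₁ (x k) else 0) • Φ x)
        + energy c U (fun x => f₂ (x k) • Φ x)
          (fun i x => f₂ (x k) • g i x + (if i = k then deriv f₂ (x k) else 0) • Φ x)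
      = energy c U Φ g
        + c * ∫ x, (deriv f₁ (x k) ^ 2 + deriv f₂ (x k) ^ 2) * ‖Φ x‖ ^ 2 := by
  have hpot := integral_add (hΦ.smul_coord h₁ k).integrable (hΦ.smul_coord h₂ k).integrable
  simp only [norm_smul_sq, ← mul_add, ← add_mul, hf, one_mul] at hpot
  have hkin := Finset.sum_congr rfl fun i (_ : i ∈ Finset.univ) =>
    hΦ.sobolev.integral_sq_gradient_smul_coord_add h₁ h₂ hf k i
  simp only [Finset.sum_add_distrib, Finset.sum_ite_eq', Finset.mem_univ, if_true] at hkin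
  simp only [energy, norm_smul_sq]
  linear_combination c * hkin - hpot

end Localization

section GroundEnergy

variable {ι : Type*} [Fintype ι] [LinearOrder ι]

theorem isSmoothMultiplier_const {E : Type*} [NormedAddCommGroup E] [NormedSpace ℝ E] (c : ℝ) :
    IsSmoothMultiplier fun _ : E => c where
  contDiff := contDiff_const
  bounded := ⟨|c|, fun _ => le_rfl⟩
  bounded_fderiv := ⟨0, fun _ => by simp⟩

theorem HasSobolevGradient.const_smul {Φ : (ι → ℝ) → ℂ} {g : ι → (ι → ℝ) → ℂ}
    (hΦ : HasSobolevGradient Φ g) (c : ℝ) :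
    HasSobolevGradient (fun x => c • Φ x) fun i x => c • g i x := by
  simpa [Pi.smul_def', Pi.add_def] using hΦ.smul (isSmoothMultiplier_const c)

theorem energyBoundedBelow_of_le_groundEnergy {Z M E : ℝ} {V : ι → ℝ → ℝ} {W : ι → ι → ℝ → ℝ}
    (hM : 0 ≤ M) (hE : (E : EReal) ≤ groundEnergy Z M V W) :
    EnergyBoundedBelow (1 / M) (totalPotential Z V W) E := by
  intro Φ g hΦ
  have hnonneg : 0 ≤ ∫ x, ‖Φ x‖ ^ 2 := integral_nonneg fun x => by positivity
  rcases hnonneg.eq_or_lt with hnorm | hnorm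
  · have hΦ0 := (integral_eq_zero_iff_of_nonneg (fun x => sq_nonneg ‖Φ x‖)
      hΦ.sobolev.integrable_sq).1 hnorm.symm
    have hpot : ∫ x, totalPotential Z V W x * ‖Φ x‖ ^ 2 = 0 :=
      integral_eq_zero_of_ae (hΦ0.mono fun x hx => mul_eq_zero_of_right _ hx)
    rw [energy, hpot, ← hnorm, mul_zero, add_zero]
    exact mul_nonneg (by positivity) (Finset.sum_nonneg fun i _ =>
      integral_nonneg fun x => by positivity)
  · have hsq : (√(∫ x, ‖Φ x‖ ^ 2))⁻¹ ^ 2 = (∫ x, ‖Φ x‖ ^ 2)⁻¹ := by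
      rw [inv_pow, Real.sq_sqrt hnonneg]
    have hmem : (∫ x, ‖Φ x‖ ^ 2)⁻¹ * energy (1 / M) (totalPotential Z V W) Φ g
        ∈ energyValues Z M V W := by
      refine ⟨_, _, hΦ.sobolev.const_smul (√(∫ x, ‖Φ x‖ ^ 2))⁻¹, ?_, ?_, ?_⟩
      · simpa only [norm_smul_sq, mul_left_comm (totalPotential Z V W _)] using
          hΦ.integrable.const_mul _
      · simp only [norm_smul_sq, integral_const_mul, hsq, inv_mul_cancel₀ hnorm.ne']
      · rw [← hsq, ← energy_const_smul]
        rfl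
    have hle := EReal.coe_le_coe_iff.1 (hE.trans (iInf₂_le _ hmem))
    rwa [inv_mul_eq_div, le_div_iff₀ hnorm] at hle

end GroundEnergy

section Uncertainty

variable {ι : Type*} [Fintype ι] [LinearOrder ι] {Φ : (ι → ℝ) → ℂ} {g : ι → (ι → ℝ) → ℂ}

theorem integrable_one_div_softAbs_mul_sq {s : ℝ} (hs : 1 ≤ s) (hΦ : HasSobolevGradient Φ g)
    (k : ι) : Integrable fun x => 1 / softAbs s (x k) * ‖Φ x‖ ^ 2 := by
  refine integrable_bdd_mul_sq hΦ.1 (C := 1) (Measurable.aestronglyMeasurable (by fun_prop))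
    fun x => ?_
  rw [abs_of_pos (one_div_pos.2 (softAbs_pos (by linarith) _))]
  exact one_div_softAbs_le_one hs _

theorem HasSobolevGradient.integral_deriv_mul_sq_le (hΦ : HasSobolevGradient Φ g) {f : ℝ → ℝ}
    (hf : IsSmoothMultiplier f) {C : ℝ} (hC : ∀ t, |f t| ≤ C) {δ : ℝ} (hδ : 0 < δ) (k : ι) :
    ∫ x, deriv f (x k) * ‖Φ x‖ ^ 2 ≤ δ * (∫ x, ‖g k x‖ ^ 2) + C ^ 2 / δ * ∫ x, ‖Φ x‖ ^ 2 := by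
  have hfm : Measurable fun x : ι → ℝ => f (x k) :=
    hf.contDiff.continuous.measurable.comp (measurable_pi_apply k)
  have hpair : Integrable fun x => f (x k) * inner ℝ (Φ x) (g k x) :=
    integrable_bdd_mul_inner hΦ.1 (hΦ.2.1 k) hfm.aestronglyMeasurable fun x => hC _
  have hg := (hΦ.integrable_sq_gradient k).const_mul δ
  have hL := hΦ.integrable_sq.const_mul (C ^ 2 / δ)
  rw [hΦ.integral_deriv_mul_sq hf k, ← integral_const_mul, ← integral_neg, ← integral_const_mul,
    ← integral_const_mul, ← integral_add hg hL]
  refine integral_mono (hpair.const_mul 2).neg (hg.add hL) fun x => ?_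
  have hcs : -(f (x k) * inner ℝ (Φ x) (g k x)) ≤ C * (‖Φ x‖ * ‖g k x‖) := by
    refine (neg_le_abs _).trans ((abs_mul _ _).trans_le ?_)
    exact mul_le_mul (hC _) (abs_real_inner_le_norm _ _) (abs_nonneg _)
      ((abs_nonneg _).trans (hC (x k)))
  have hyoung : 2 * (C * (‖Φ x‖ * ‖g k x‖)) ≤ δ * ‖g k x‖ ^ 2 + C ^ 2 / δ * ‖Φ x‖ ^ 2 := by
    have hsq : δ * ‖g k x‖ ^ 2 + C ^ 2 / δ * ‖Φ x‖ ^ 2 - 2 * (C * (‖Φ x‖ * ‖g k x‖))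
        = (δ * ‖g k x‖ - C * ‖Φ x‖) ^ 2 / δ := by
      field_simp
      ring
    linarith [div_nonneg (sq_nonneg (δ * ‖g k x‖ - C * ‖Φ x‖)) hδ.le]
  simp only
  linarith

theorem HasSobolevGradient.integral_one_div_softAbs_le (hΦ : HasSobolevGradient Φ g) {L δ : ℝ}
    (hL : 1 ≤ L) (hδ : 0 < δ) (k : ι) :
    ∫ x, 1 / softAbs 1 (x k) * ‖Φ x‖ ^ 2
      ≤ δ * (∫ x, ‖g k x‖ ^ 2) + (Real.log L ^ 2 / δ + 1 / L) * ∫ x, ‖Φ x‖ ^ 2 := by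
  have hL0 : 0 < L := by linarith
  have hmul : IsSmoothMultiplier (logPrimitive L) := isSmoothMultiplier_of_deriv
    (contDiff_logPrimitive L) (abs_logPrimitive_le hL) (abs_deriv_logPrimitive_le hL)
  have hnear := hΦ.integral_deriv_mul_sq_le hmul (abs_logPrimitive_le hL) hδ k
  have hfar : ∫ x, 1 / softAbs (L ^ 2) (x k) * ‖Φ x‖ ^ 2 ≤ 1 / L * ∫ x, ‖Φ x‖ ^ 2 := by
    rw [← integral_const_mul]
    exact integral_mono (integrable_one_div_softAbs_mul_sq (one_le_pow₀ hL) hΦ k)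
      (hΦ.integrable_sq.const_mul _) fun x =>
        mul_le_mul_of_nonneg_right (one_div_softAbs_sq_le hL0 _) (sq_nonneg _)
  simp only [fun x => (hasDerivAt_logPrimitive hL0 x).deriv, sub_mul] at hnear
  rw [integral_sub (integrable_one_div_softAbs_mul_sq le_rfl hΦ k)
    (integrable_one_div_softAbs_mul_sq (one_le_pow₀ hL) hΦ k)] at hnear
  linarith

end Uncertainty

namespace CoulombBounds

variable {ι : Type*} [Fintype ι] [LinearOrder ι] {s Z M E E' : ℝ} {V : ι → ℝ → ℝ}
  {W : ι → ι → ℝ → ℝ} {Φ : (ι → ℝ) → ℂ} {g : ι → (ι → ℝ) → ℂ} {k : ι}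

theorem removal_le (h : CoulombBounds s V W) (hZ : 0 ≤ Z)
    (hE' : EnergyBoundedBelow (1 / M) (totalPotentialRemove Z V W k) E')
    (hΦ : InFormDomain (totalPotential Z V W) Φ g) :
    E' * (∫ x, ‖Φ x‖ ^ 2) + 1 / M * (∫ x, ‖g k x‖ ^ 2)
        + ∫ x, interactionWith W k x * ‖Φ x‖ ^ 2
      ≤ energy (1 / M) (totalPotential Z V W) Φ g - ∫ x, -Z * V k (x k) * ‖Φ x‖ ^ 2 := by
  have hrest := h.integrable_totalPotentialRemove hZ hΦ k
  have hatt := h.integrable_attraction hZ hΦ k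
  have hslice := EnergyBoundedBelow.le_integral_slice (p := (· = k)) hE' hΦ.sobolev hrest
  have hpot : ∫ x, totalPotential Z V W x * ‖Φ x‖ ^ 2
      = (∫ x, totalPotentialRemove Z V W k (fun j => x j) * ‖Φ x‖ ^ 2)
        + (∫ x, -Z * V k (x k) * ‖Φ x‖ ^ 2) + ∫ x, interactionWith W k x * ‖Φ x‖ ^ 2 := by
    have hsum : Integrable fun x => totalPotentialRemove Z V W k (fun j => x j) * ‖Φ x‖ ^ 2
        + -Z * V k (x k) * ‖Φ x‖ ^ 2 := hrest.add hatt
    simp only [totalPotential_eq_remove_add Z V W k, add_mul]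
    rw [integral_add hsum (h.integrable_interactionWith hZ hΦ k), integral_add hrest hatt]
  rw [energy, hpot, Fintype.sum_eq_add_sum_subtype_ne _ k]
  linarith

theorem kinetic_le (h : CoulombBounds s V W) (hZ : 0 ≤ Z)
    (hE' : EnergyBoundedBelow (1 / M) (totalPotentialRemove Z V W k) E')
    (hΦ : InFormDomain (totalPotential Z V W) Φ g)
    (hlow : energy (1 / M) (totalPotential Z V W) Φ g ≤ E' * ∫ x, ‖Φ x‖ ^ 2) :
    1 / M * (∫ x, ‖g k x‖ ^ 2) ≤ 3 * Z * ∫ x, 1 / softAbs 1 (x k) * ‖Φ x‖ ^ 2 := by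
  have hremove := h.removal_le hZ hE' hΦ
  have hrep : 0 ≤ ∫ x, interactionWith W k x * ‖Φ x‖ ^ 2 :=
    integral_nonneg fun x => mul_nonneg (h.interactionWith_nonneg k x) (sq_nonneg _)
  have hatt : -(∫ x, -Z * V k (x k) * ‖Φ x‖ ^ 2)
      ≤ 3 * Z * ∫ x, 1 / softAbs 1 (x k) * ‖Φ x‖ ^ 2 := by
    rw [← integral_neg, ← integral_const_mul]
    refine integral_mono (h.integrable_attraction hZ hΦ k).neg
      ((integrable_one_div_softAbs_mul_sq le_rfl hΦ.sobolev k).const_mul _) fun x => ?_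
    have hV := mul_le_mul_of_nonneg_right (mul_le_mul_of_nonneg_left
      (h.attraction_le_mul_one_div_softAbs k (x k)) hZ) (sq_nonneg ‖Φ x‖)
    simp only
    linarith
  linarith

theorem integral_one_div_softAbs_le (h : CoulombBounds s V W) (hZ : 0 < Z) (hM : 0 < M) {L : ℝ}
    (hL : 1 ≤ L) (hE' : EnergyBoundedBelow (1 / M) (totalPotentialRemove Z V W k) E')
    (hΦ : InFormDomain (totalPotential Z V W) Φ g)
    (hlow : energy (1 / M) (totalPotential Z V W) Φ g ≤ E' * ∫ x, ‖Φ x‖ ^ 2) :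
    ∫ x, 1 / softAbs 1 (x k) * ‖Φ x‖ ^ 2
      ≤ (12 * Z * M * Real.log L ^ 2 + 2 / L) * ∫ x, ‖Φ x‖ ^ 2 := by
  have hkin := h.kinetic_le hZ.le hE' hΦ hlow
  rw [one_div_mul_eq_div, div_le_iff₀ hM] at hkin
  -- `δ` is chosen such that the kinetic term absorbs half of the left-hand side.
  have hunc := hΦ.sobolev.integral_one_div_softAbs_le hL (δ := 1 / (6 * Z * M)) (by positivity) k
  have habsorb : 1 / (6 * Z * M) * (∫ x, ‖g k x‖ ^ 2)
      ≤ 1 / 2 * ∫ x, 1 / softAbs 1 (x k) * ‖Φ x‖ ^ 2 := by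
    rw [one_div_mul_eq_div, div_le_iff₀ (by positivity)]
    linarith
  have hcoef : 12 * Z * M * Real.log L ^ 2 + 2 / L
      = 2 * (Real.log L ^ 2 / (1 / (6 * Z * M)) + 1 / L) := by
    field_simp
    ring
  rw [hcoef]
  linarith

end CoulombBounds

section SaturatedCutoff

variable {ε s : ℝ}

theorem isSmoothMultiplier_sqrt {q : ℝ → ℝ} (hq : ContDiff ℝ ∞ q) (h₀ : ∀ x, 0 < q x)
    (h₁ : ∀ x, q x ≤ 1) {C : ℝ} (hC : ∀ x, deriv (fun y => √(q y)) x ^ 2 ≤ C) :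
    IsSmoothMultiplier fun x => √(q x) :=
  isSmoothMultiplier_of_deriv (C := 1) (hq.sqrt fun x => (h₀ x).ne')
    (fun x => by simpa [abs_of_nonneg (Real.sqrt_nonneg _)] using h₁ x)
    fun x => Real.abs_le_sqrt (hC x)

theorem sq_deriv_sqrt_saturatedWeight_le_const (hε : 0 < ε) (hs : 1 ≤ s) (x : ℝ) :
    deriv (fun y => √(1 - saturatedWeight ε s y)) x ^ 2
      + deriv (fun y => √(saturatedWeight ε s y)) x ^ 2 ≤ ε / 4 :=
  (sq_deriv_sqrt_saturatedWeight_le hε hs x).trans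
    (mul_le_of_le_one_right (by positivity) (one_div_softAbs_le_one le_rfl x))

theorem isSmoothMultiplier_sqrt_saturatedWeight (hε : 0 < ε) (hs : 1 ≤ s) :
    IsSmoothMultiplier fun x => √(saturatedWeight ε s x) :=
  have hs' : 0 < s := by linarith
  isSmoothMultiplier_sqrt (contDiff_saturatedWeight hε hs') (saturatedWeight_pos hε hs')
    (fun x => (saturatedWeight_lt_one hε hs' x).le) fun x =>
      (le_add_of_nonneg_left (sq_nonneg _)).trans (sq_deriv_sqrt_saturatedWeight_le_const hε hs x)

theorem isSmoothMultiplier_sqrt_one_sub_saturatedWeight (hε : 0 < ε) (hs : 1 ≤ s) :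
    IsSmoothMultiplier fun x => √(1 - saturatedWeight ε s x) :=
  have hs' : 0 < s := by linarith
  isSmoothMultiplier_sqrt (contDiff_const.sub (contDiff_saturatedWeight hε hs'))
    (fun x => sub_pos.2 (saturatedWeight_lt_one hε hs' x))
    (fun x => (sub_lt_self _ (saturatedWeight_pos hε hs' x)).le) fun x =>
      (le_add_of_nonneg_right (sq_nonneg _)).trans (sq_deriv_sqrt_saturatedWeight_le_const hε hs x)

theorem integrable_saturatedWeight_mul (hε : 0 < ε) (hs : 0 < s) {ι : Type*} [Fintype ι] (k : ι)
    {u : (ι → ℝ) → ℝ} (hu : Integrable u) : Integrable fun x => saturatedWeight ε s (x k) * u x :=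
  hu.bdd_mul ((contDiff_saturatedWeight hε hs).continuous.comp
      (continuous_apply k)).aestronglyMeasurable (c := 1)
    (ae_of_all _ fun x => by
      rw [Real.norm_of_nonneg (saturatedWeight_pos hε hs _).le]
      exact (saturatedWeight_lt_one hε hs _).le)

end SaturatedCutoff

section WeightedRemoval

variable {ι : Type*} [Fintype ι] [LinearOrder ι] {s Z M L ε E E' : ℝ} {V : ι → ℝ → ℝ}
  {W : ι → ι → ℝ → ℝ} {Φ : (ι → ℝ) → ℂ} {g : ι → (ι → ℝ) → ℂ} {k : ι}

theorem HasSobolevGradient.integral_sq_deriv_sqrt_saturatedWeight_le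
    (hΦ : HasSobolevGradient Φ g) (hε : 0 < ε) (hs : 1 ≤ s) (k : ι) :
    ∫ x, (deriv (fun y => √(1 - saturatedWeight ε s y)) (x k) ^ 2
          + deriv (fun y => √(saturatedWeight ε s y)) (x k) ^ 2) * ‖Φ x‖ ^ 2
      ≤ ε / 4 * ∫ x, 1 / softAbs 1 (x k) * ‖Φ x‖ ^ 2 := by
  rw [← integral_const_mul]
  refine integral_mono_of_nonneg (ae_of_all _ fun x => ?_)
    ((integrable_one_div_softAbs_mul_sq le_rfl hΦ k).const_mul _) (ae_of_all _ fun x => ?_)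
  · exact mul_nonneg (by positivity) (sq_nonneg _)
  · simp only [← mul_assoc]
    exact mul_le_mul_of_nonneg_right (sq_deriv_sqrt_saturatedWeight_le hε hs _) (sq_nonneg _)

theorem CoulombBounds.neg_integral_attraction_mul_saturatedWeight_le (h : CoulombBounds s V W)
    (hZ : 0 ≤ Z) (hΦ : InFormDomain (totalPotential Z V W) Φ g) (hε : 0 < ε) (k : ι) :
    -(∫ x, -Z * V k (x k) * (saturatedWeight ε s (x k) * ‖Φ x‖ ^ 2))
      ≤ 3 * Z * ε * ∫ x, ‖Φ x‖ ^ 2 := by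
  have hs : 0 < s := by linarith [h.one_le]
  have hint := integrable_saturatedWeight_mul hε hs k (h.integrable_attraction hZ hΦ k)
  rw [← integral_neg, ← integral_const_mul]
  refine integral_mono (hint.neg.congr (ae_of_all _ fun x => ?_))
    (hΦ.sobolev.integrable_sq.const_mul _) fun x => ?_
  · simp only [Pi.neg_apply]
    ring
  · have hV := mul_le_mul_of_nonneg_right (mul_le_mul_of_nonneg_left
      (mul_saturatedWeight_le hε hs zero_le_three (h.attraction_le k (x k))) hZ) (sq_nonneg ‖Φ x‖)
    simp only
    linarith

theorem CoulombBounds.localization_error_le (h : CoulombBounds s V W) (hZ : 0 < Z) (hM : 0 < M)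
    (hL : 1 ≤ L) (hε : 0 < ε)
    (hE' : EnergyBoundedBelow (1 / M) (totalPotentialRemove Z V W k) E')
    (hΦ : InFormDomain (totalPotential Z V W) Φ g)
    (hlow : energy (1 / M) (totalPotential Z V W) Φ g ≤ E' * ∫ x, ‖Φ x‖ ^ 2) :
    1 / M * ∫ x, (deriv (fun y => √(1 - saturatedWeight ε s y)) (x k) ^ 2
          + deriv (fun y => √(saturatedWeight ε s y)) (x k) ^ 2) * ‖Φ x‖ ^ 2
      ≤ ε * (3 * Z * Real.log L ^ 2 + 1 / (2 * L * M)) * ∫ x, ‖Φ x‖ ^ 2 := by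
  have : 0 < L := by linarith
  calc _ ≤ 1 / M * (ε / 4 * ((12 * Z * M * Real.log L ^ 2 + 2 / L) * ∫ x, ‖Φ x‖ ^ 2)) := by
        gcongr
        exact (hΦ.sobolev.integral_sq_deriv_sqrt_saturatedWeight_le hε h.one_le k).trans
          (mul_le_mul_of_nonneg_left (h.integral_one_div_softAbs_le hZ hM hL hE' hΦ hlow)
            (by positivity))
    _ = _ := by
        field_simp
        ring

theorem CoulombBounds.removal_sqrt_saturatedWeight_le (h : CoulombBounds s V W) (hZ : 0 ≤ Z)
    (hM : 0 ≤ M) (hε : 0 < ε)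
    (hE' : EnergyBoundedBelow (1 / M) (totalPotentialRemove Z V W k) E')
    (hΦ : InFormDomain (totalPotential Z V W) Φ g) :
    E' * (∫ x, saturatedWeight ε s (x k) * ‖Φ x‖ ^ 2)
        + ∫ x, interactionWith W k x * (saturatedWeight ε s (x k) * ‖Φ x‖ ^ 2)
      ≤ energy (1 / M) (totalPotential Z V W) (fun x => √(saturatedWeight ε s (x k)) • Φ x)
          (fun i x => √(saturatedWeight ε s (x k)) • g i x
            + (if i = k then deriv (fun y => √(saturatedWeight ε s y)) (x k) else 0) • Φ x)
        + 3 * Z * ε * ∫ x, ‖Φ x‖ ^ 2 := by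
  have hs : 0 < s := by linarith [h.one_le]
  have hremove := h.removal_le hZ hE'
    (hΦ.smul_coord (isSmoothMultiplier_sqrt_saturatedWeight hε h.one_le) k)
  have hkin : 0 ≤ 1 / M * ∫ x, ‖√(saturatedWeight ε s (x k)) • g k x
      + deriv (fun y => √(saturatedWeight ε s y)) (x k) • Φ x‖ ^ 2 :=
    mul_nonneg (by positivity) (integral_nonneg fun x => sq_nonneg _)
  have hatt := h.neg_integral_attraction_mul_saturatedWeight_le hZ hΦ hε k
  simp only [norm_smul_sq, Real.sq_sqrt (saturatedWeight_pos hε hs _).le, ↓reduceIte] at hremove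
  linarith

/-- By the localization formula the part of a near-minimizer pushed to large `x_k` has at most the
energy left over by the other part, whose energy is at least the ground state energy. -/
theorem CoulombBounds.weighted_removal_le (h : CoulombBounds s V W) (hZ : 0 < Z) (hM : 0 < M)
    (hL : 1 ≤ L) (hε : 0 < ε) (hE : EnergyBoundedBelow (1 / M) (totalPotential Z V W) E)
    (hE' : EnergyBoundedBelow (1 / M) (totalPotentialRemove Z V W k) E')
    (hΦ : InFormDomain (totalPotential Z V W) Φ g) (hnorm : ∫ x, ‖Φ x‖ ^ 2 = 1)
    (hnear : energy (1 / M) (totalPotential Z V W) Φ g ≤ E + ε) (hgap : E + ε ≤ E') :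
    (E' - E) * (∫ x, saturatedWeight ε s (x k) * ‖Φ x‖ ^ 2)
        + ∫ x, interactionWith W k x * (saturatedWeight ε s (x k) * ‖Φ x‖ ^ 2)
      ≤ ε * (1 + 3 * Z + 3 * Z * Real.log L ^ 2 + 1 / (2 * L * M)) := by
  have hs : 0 < s := by linarith [h.one_le]
  have hq (t : ℝ) : 0 ≤ saturatedWeight ε s t := (saturatedWeight_pos hε hs t).le
  have hq' (t : ℝ) : 0 ≤ 1 - saturatedWeight ε s t :=
    (sub_pos.2 (saturatedWeight_lt_one hε hs t)).le
  have hmul₁ := isSmoothMultiplier_sqrt_one_sub_saturatedWeight hε h.one_le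
  have hmul₂ := isSmoothMultiplier_sqrt_saturatedWeight hε h.one_le
  have hims := hΦ.energy_smul_coord_add (1 / M) hmul₁ hmul₂
    (fun t => by rw [Real.sq_sqrt (hq' t), Real.sq_sqrt (hq t), sub_add_cancel]) k
  have herr := h.localization_error_le hZ hM hL hε hE' hΦ (by rw [hnorm]; linarith)
  have hbound := hE _ _ (hΦ.smul_coord hmul₁ k)
  have hremove := h.removal_sqrt_saturatedWeight_le hZ.le hM.le hε hE' hΦ
  simp only [norm_smul_sq, Real.sq_sqrt (hq' _), sub_mul, one_mul] at hbound
  rw [integral_sub hΦ.sobolev.integrable_sq (integrable_saturatedWeight_mul hε hs k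
    hΦ.sobolev.integrable_sq)] at hbound
  rw [hnorm] at herr hbound hremove
  linarith

end WeightedRemoval

section PairSums

variable {ι : Type*} [Fintype ι]

theorem sum_sum_mul_add (p : ι → ι → ℝ) (w : ι → ℝ) :
    ∑ k, ∑ j, p k j * (w k + w j) = ∑ k, w k * ∑ j, (p k j + p j k) := by
  have hswap : ∑ k, ∑ j, p k j * w j = ∑ k, ∑ j, p j k * w k := Finset.sum_comm
  simp only [mul_add, Finset.sum_add_distrib, hswap, Finset.mul_sum, mul_comm]

theorem ae_coord_ne {i j : ι} (hij : i ≠ j) : ∀ᵐ x : ι → ℝ, x i ≠ x j := by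
  classical
  set diagonal : Submodule ℝ (ι → ℝ) :=
    LinearMap.ker ((LinearMap.proj i : (ι → ℝ) →ₗ[ℝ] ℝ) - LinearMap.proj j) with hdiagonal
  have hne : diagonal ≠ ⊤ := fun htop => by
    have hsingle : (Pi.single i 1 : ι → ℝ) ∈ diagonal := htop ▸ Submodule.mem_top
    simp [hdiagonal, hij] at hsingle
  have hnull := Measure.addHaar_submodule (volume : Measure (ι → ℝ)) diagonal hne
  rw [ae_iff]
  convert hnull using 2
  ext x
  simp [hdiagonal, sub_eq_zero]

theorem ae_injective : ∀ᵐ x : ι → ℝ, Function.Injective x := by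
  have hae : ∀ᵐ x : ι → ℝ, ∀ i j, i ≠ j → x i ≠ x j :=
    ae_all_iff.2 fun i => ae_all_iff.2 fun j => ae_all_iff.2 fun hij => ae_coord_ne hij
  filter_upwards [hae] with x hx i j
  exact not_imp_not.1 (hx i j)

variable [LinearOrder ι]

theorem sum_ite_lt_add_ite_lt (k : ι) :
    ∑ j, ((if k < j then (1 : ℝ) else 0) + if j < k then 1 else 0) = Fintype.card ι - 1 := by
  have hne (j : ι) : ((if k < j then (1 : ℝ) else 0) + if j < k then 1 else 0)
      = 1 - if j = k then 1 else 0 := by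
    rcases lt_trichotomy j k with h | rfl | h
    · simp [h, h.not_gt, h.ne]
    · simp
    · simp [h, h.not_gt, h.ne']
  simp [hne]

theorem sum_sum_ite_lt_mul_add (w : ι → ℝ) :
    ∑ k, ∑ j, (if k < j then (1 : ℝ) else 0) * (w k + w j) = (Fintype.card ι - 1) * ∑ k, w k := by
  rw [sum_sum_mul_add (fun k j => if k < j then (1 : ℝ) else 0)]
  simp only [sum_ite_lt_add_ite_lt, ← Finset.sum_mul, mul_comm]

end PairSums

namespace CoulombBounds

variable {ι : Type*} [Fintype ι] [LinearOrder ι] {s Z ε : ℝ} {V : ι → ℝ → ℝ}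
  {W : ι → ι → ℝ → ℝ} {Φ : (ι → ℝ) → ℂ} {g : ι → (ι → ℝ) → ℂ}

theorem le_sum_interactionWith_mul_saturatedWeight (h : CoulombBounds s V W) (hε : 0 < ε)
    {x : ι → ℝ} (hx : Function.Injective x) :
    (Fintype.card ι - 1) * ∑ k, ε * (1 / 2 - saturatedWeight ε s (x k))
      ≤ ∑ k, interactionWith W k x * saturatedWeight ε s (x k) := by
  simp only [interactionWith, mul_comm _ (saturatedWeight _ _ _)]
  rw [← sum_sum_ite_lt_mul_add, ← sum_sum_mul_add fun k j => pairPotential W k j x]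
  refine Finset.sum_le_sum fun k _ => Finset.sum_le_sum fun j _ => ?_
  unfold pairPotential
  split_ifs with hkj
  · have hpair := mul_one_sub_saturatedWeight_le hε (zero_lt_one.trans_le h.one_le)
      (h.le_repulsion k j hkj _ (sub_ne_zero.2 (hx.ne hkj.ne)))
    linarith
  · simp

theorem le_sum_integral_interactionWith_mul_saturatedWeight (h : CoulombBounds s V W) (hZ : 0 ≤ Z)
    (hε : 0 < ε) (hΦ : InFormDomain (totalPotential Z V W) Φ g) :
    (Fintype.card ι - 1) * ∑ k, ε * (1 / 2 * (∫ x, ‖Φ x‖ ^ 2)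
          - ∫ x, saturatedWeight ε s (x k) * ‖Φ x‖ ^ 2)
      ≤ ∑ k, ∫ x, interactionWith W k x * (saturatedWeight ε s (x k) * ‖Φ x‖ ^ 2) := by
  have hs : 0 < s := zero_lt_one.trans_le h.one_le
  have hweight (k : ι) := integrable_saturatedWeight_mul hε hs k hΦ.sobolev.integrable_sq
  have hhalf := hΦ.sobolev.integrable_sq.const_mul (1 / 2)
  have hrep (k : ι) : Integrable fun x =>
      interactionWith W k x * (saturatedWeight ε s (x k) * ‖Φ x‖ ^ 2) := by
    simpa only [mul_left_comm] using
      integrable_saturatedWeight_mul hε hs k (h.integrable_interactionWith hZ hΦ k)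
  have hdiff (k : ι) : Integrable fun x =>
      ε * (1 / 2 * ‖Φ x‖ ^ 2 - saturatedWeight ε s (x k) * ‖Φ x‖ ^ 2) :=
    (hhalf.sub (hweight k)).const_mul ε
  simp only [← integral_const_mul, ← integral_sub hhalf (hweight _)]
  rw [← integral_finsetSum _ fun k _ => hdiff k, ← integral_finsetSum _ fun k _ => hrep k,
    ← integral_const_mul]
  refine integral_mono_ae ((integrable_finsetSum _ fun k _ => hdiff k).const_mul _)
    (integrable_finsetSum _ fun k _ => hrep k) ?_
  filter_upwards [ae_injective] with x hx
  have hpointwise := mul_le_mul_of_nonneg_right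
    (h.le_sum_interactionWith_mul_saturatedWeight hε hx) (sq_nonneg ‖Φ x‖)
  simpa only [mul_assoc, Finset.sum_mul, sub_mul] using hpointwise

theorem neg_three_mul_card_le_groundEnergy {M : ℝ} (h : CoulombBounds s V W) (hZ : 0 ≤ Z)
    (hM : 0 ≤ M) : ((-(3 * Z * Fintype.card ι) : ℝ) : EReal) ≤ groundEnergy Z M V W := by
  refine le_iInf₂ fun e ⟨Φ, g, hΦ, hint, hnorm, he⟩ => EReal.coe_le_coe_iff.2 ?_
  have hpot := integral_mono (hΦ.integrable_sq.const_mul _) hint fun x =>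
    mul_le_mul_of_nonneg_right (h.neg_three_mul_card_le_totalPotential hZ x) (sq_nonneg ‖Φ x‖)
  rw [integral_const_mul, hnorm, mul_one] at hpot
  have hkin : 0 ≤ 1 / M * ∑ i, ∫ x, ‖g i x‖ ^ 2 :=
    mul_nonneg (by positivity) (Finset.sum_nonneg fun i _ => integral_nonneg fun x => sq_nonneg _)
  linarith

end CoulombBounds

section MaximalIonization

variable {ι : Type*} [Fintype ι] [LinearOrder ι] {s Z M : ℝ} {V : ι → ℝ → ℝ} {W : ι → ι → ℝ → ℝ}

theorem exists_energy_le_add {E ε : ℝ} (hE : groundEnergy Z M V W = E) (hε : 0 < ε) :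
    ∃ Φ g, InFormDomain (totalPotential Z V W) Φ g ∧ ∫ x, ‖Φ x‖ ^ 2 = 1 ∧
      energy (1 / M) (totalPotential Z V W) Φ g ≤ E + ε := by
  have hlt : groundEnergy Z M V W < (E + ε : ℝ) := by
    rw [hE, EReal.coe_lt_coe_iff]
    linarith
  obtain ⟨e, ⟨Φ, g, hΦ, hint, hnorm, rfl⟩, he⟩ := by
    simpa only [groundEnergy, iInf_lt_iff, exists_prop] using hlt
  exact ⟨Φ, g, ⟨hΦ, hint⟩, hnorm, (EReal.coe_lt_coe_iff.1 he).le⟩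

theorem CoulombBounds.exists_energyBoundedBelow_of_hasBoundState (h : CoulombBounds s V W)
    (hZ : 0 ≤ Z) (hM : 0 ≤ M) (hb : HasBoundState Z M V W) :
    ∃ E E' : ℝ, E < E' ∧ groundEnergy Z M V W = E ∧
      ∀ k, EnergyBoundedBelow (1 / M) (totalPotentialRemove Z V W k) E' := by
  obtain ⟨E', hE, hE'⟩ := EReal.lt_iff_exists_real_btwn.1 hb
  have hbot := (EReal.bot_lt_coe _).trans_le (h.neg_three_mul_card_le_groundEnergy hZ hM)
  have hcoe := EReal.coe_toReal (hE.trans_le le_top).ne hbot.ne'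
  exact ⟨_, E', EReal.coe_lt_coe_iff.1 (hcoe.trans_lt hE), hcoe.symm,
    fun k => energyBoundedBelow_of_le_groundEnergy hM (hE'.le.trans (iInf_le _ k))⟩

theorem CoulombBounds.card_le_of_hasBoundState (h : CoulombBounds s V W) (hZ : 0 < Z) (hM : 0 < M)
    (hb : HasBoundState Z M V W) {L : ℝ} (hL : 1 ≤ L) :
    (Fintype.card ι : ℝ) ≤ 3 + 2 * (3 * Z + 3 * Z * Real.log L ^ 2 + 1 / (2 * L * M)) := by
  obtain ⟨E, E', hgap, hE, hE'⟩ := h.exists_energyBoundedBelow_of_hasBoundState hZ.le hM.le hb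
  set D := 1 + 3 * Z + 3 * Z * Real.log L ^ 2 + 1 / (2 * L * M) with hD
  set n := (Fintype.card ι : ℝ) with hn
  have : 0 < L := by linarith
  have hn_nonneg : 0 ≤ n := Nat.cast_nonneg _
  rcases hn_nonneg.eq_or_lt with hn0 | hn0
  · rw [← hn0]
    positivity
  -- The second estimate makes the localization gain `E' - E` absorb the loss in the pair sum.
  obtain ⟨ε, hε, hεgap, hεn⟩ : ∃ ε > 0, E + ε ≤ E' ∧ ε * (n - 1) ≤ E' - E := by
    have hgap' : 0 < E' - E := sub_pos.2 hgap
    refine ⟨(E' - E) / (n + 1), by positivity, ?_, ?_⟩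
    · linarith [div_le_self hgap'.le (by linarith : 1 ≤ n + 1)]
    · rw [div_mul_eq_mul_div, div_le_iff₀ (by positivity)]
      nlinarith
  obtain ⟨Φ, g, hΦ, hnorm, hnear⟩ := exists_energy_le_add hE hε
  have hsum := Finset.sum_le_sum fun k (_ : k ∈ Finset.univ) =>
    h.weighted_removal_le hZ hM hL hε (energyBoundedBelow_of_le_groundEnergy hM.le hE.ge) (hE' k)
      hΦ hnorm hnear hεgap
  have hpairs := h.le_sum_integral_interactionWith_mul_saturatedWeight hZ.le hε hΦ
  set Q := ∑ k, ∫ x, saturatedWeight ε s (x k) * ‖Φ x‖ ^ 2 with hQ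
  have hQ0 : 0 ≤ Q := Finset.sum_nonneg fun k _ => integral_nonneg fun x =>
    mul_nonneg (saturatedWeight_pos hε (zero_lt_one.trans_le h.one_le) _).le (sq_nonneg _)
  simp only [← Finset.mul_sum, Finset.sum_add_distrib, Finset.sum_sub_distrib, hnorm, ← hQ,
    Finset.sum_const, Finset.card_univ, nsmul_eq_mul, ← hn, ← hD] at hsum hpairs
  have habsorb := mul_le_mul_of_nonneg_right hεn hQ0
  have hfinal : ε * n * ((n - 1) / 2) ≤ ε * n * D := by linarith
  linarith [le_of_mul_le_mul_left hfinal (by positivity)]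

end MaximalIonization

section StrongFieldScaling

variable {a p Z Z₀ : ℝ}

theorem one_div_two_mul_rpow_mul_rpow_neg_half_le (ha : 0 < a) (hZ : 1 ≤ Z) :
    1 / (2 * Z ^ (|p| / 2) * (a * Z ^ p) ^ (-(1 / 2) : ℝ)) ≤ √a / 2 := by
  have hZ' : 0 < Z := by linarith
  have hmass : (a * Z ^ p) ^ (-(1 / 2) : ℝ) = (√a * Z ^ (p / 2))⁻¹ := by
    rw [Real.rpow_neg (by positivity), Real.mul_rpow ha.le (by positivity), ← Real.sqrt_eq_rpow,
      ← Real.rpow_mul hZ'.le, mul_one_div]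
  have hpow : Z ^ (p / 2) ≤ Z ^ (|p| / 2) :=
    Real.rpow_le_rpow_of_exponent_le hZ (by linarith [le_abs_self p])
  rw [hmass, one_div_le (by positivity) (by positivity), ← div_eq_mul_inv,
    le_div_iff₀ (by positivity)]
  calc 1 / (√a / 2) * (√a * Z ^ (p / 2)) = 2 * Z ^ (p / 2) := by field_simp
    _ ≤ 2 * Z ^ (|p| / 2) := by gcongr

/-- The constant `A` of the ionization bound `3 Z + A Z (log Z) ^ 2`, for charges `Z ≥ Z₀` and field
strength `B = a Z ^ p`. -/
noncomputable def ionizationConstant (a p Z₀ : ℝ) : ℝ :=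
  (6 + √a) / Real.log Z₀ ^ 2 + 3 * p ^ 2 / 2

theorem ionizationConstant_pos (a p : ℝ) (hZ₀ : 1 < Z₀) : 0 < ionizationConstant a p Z₀ := by
  have := Real.log_pos hZ₀
  unfold ionizationConstant
  positivity

theorem add_two_mul_le_add_ionizationConstant_mul (a p : ℝ) (hZ₀ : 1 < Z₀) (hZ : Z₀ ≤ Z) :
    3 + 2 * (3 * Z + 3 * Z * Real.log (Z ^ (|p| / 2)) ^ 2 + √a / 2)
      ≤ 3 * Z + ionizationConstant a p Z₀ * Z * Real.log Z ^ 2 := by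
  have hlog₀ : 0 < Real.log Z₀ := Real.log_pos hZ₀
  have hZ' : 0 < Z := by linarith
  have hconst : 6 + √a ≤ (6 + √a) / Real.log Z₀ ^ 2 * Real.log Z ^ 2 := by
    rw [div_mul_eq_mul_div, le_div_iff₀ (by positivity)]
    gcongr
  have hscaled := mul_le_mul_of_nonneg_right hconst hZ'.le
  have hsqrt : √a ≤ √a * Z := le_mul_of_one_le_right (Real.sqrt_nonneg a) (by linarith)
  rw [Real.log_rpow hZ', mul_pow, div_pow, sq_abs, ionizationConstant]
  linarith

theorem PotentialBounds.card_le_of_hasBoundState {ι : Type*} [Fintype ι] [LinearOrder ι] {μ ν : ℕ}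
    {V : ι → ℝ → ℝ} {W : ι → ι → ℝ → ℝ} (h : PotentialBounds μ ν V W) (hνμ : ν ≤ 2 * (μ + 1))
    (ha : 0 < a) (hZ₀ : 1 < Z₀) (hZ : Z₀ ≤ Z)
    (hb : HasBoundState Z ((a * Z ^ p) ^ (-(1 / 2) : ℝ)) V W) :
    (Fintype.card ι : ℝ) ≤ 3 * Z + ionizationConstant a p Z₀ * Z * Real.log Z ^ 2 := by
  have hZ1 : 1 ≤ Z := hZ₀.le.trans hZ
  have hcard := (h.coulombBounds hνμ).card_le_of_hasBoundState (by positivity) (by positivity) hb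
    (Real.one_le_rpow hZ1 (by positivity : 0 ≤ |p| / 2))
  have hfield := one_div_two_mul_rpow_mul_rpow_neg_half_le (p := p) ha hZ1
  have hconst := add_two_mul_le_add_ionizationConstant_mul a p hZ₀ hZ
  linarith

theorem exists_maxElectrons_eq {M C : ℝ} {V : (N : ℕ) → Fin N → ℝ → ℝ}
    {W : (N : ℕ) → Fin N → Fin N → ℝ → ℝ} (hC : 0 ≤ C)
    (h : ∀ N, HasBoundState Z M (V N) (W N) → (N : ℝ) ≤ C) :
    ∃ n : ℕ, maxElectrons Z M V W = n ∧ (n : ℝ) ≤ C := by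
  have hle : maxElectrons Z M V W ≤ (⌊C⌋₊ : ℕ∞) :=
    iSup₂_le fun N hN => Nat.cast_le.2 (Nat.le_floor (h N hN))
  lift maxElectrons Z M V W to ℕ using ne_top_of_le_ne_top (ENat.natCast_ne_top _) hle with n
  exact ⟨n, rfl, (Nat.le_floor_iff hC).1 (Nat.cast_le.1 hle)⟩

end StrongFieldScaling

end StrongField

theorem corollary3_general (a p Z₀ : ℝ) (ha : 0 < a) (hZ₀ : 1 < Z₀) :
    ∃ A : ℝ, 0 < A ∧ ∀ Z B : ℝ, Z₀ ≤ Z → B = a * Z ^ p →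
      (∀ (ι : Type*) [Fintype ι] [LinearOrder ι] (μ ν : ℕ) (V : ι → ℝ → ℝ) (W : ι → ι → ℝ → ℝ),
        ν ≤ 2 * (μ + 1) → StrongField.PotentialBounds μ ν V W →
        3 * Z + A * Z * Real.log Z ^ 2 < Fintype.card ι →
        ¬ StrongField.HasBoundState Z (B ^ (-(1 / 2) : ℝ)) V W) ∧
      (∀ (μ ν : ℕ → ℕ) (V : (N : ℕ) → Fin N → ℝ → ℝ) (W : (N : ℕ) → Fin N → Fin N → ℝ → ℝ),
        (∀ N, ν N ≤ 2 * (μ N + 1) ∧ StrongField.PotentialBounds (μ N) (ν N) (V N) (W N)) →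
        ∃ n : ℕ, StrongField.maxElectrons Z (B ^ (-(1 / 2) : ℝ)) V W = (n : ℕ∞) ∧
          (n : ℝ) ≤ 3 * Z + A * Z * Real.log Z ^ 2) := by
  have hA := StrongField.ionizationConstant_pos a p hZ₀
  refine ⟨_, hA, fun Z B hZ hB => ⟨fun ι _ _ μ ν V W hνμ hVW hcard hb => ?_, fun μ ν V W hVW => ?_⟩⟩
  · exact hcard.not_ge (hVW.card_le_of_hasBoundState hνμ ha hZ₀ hZ (hB ▸ hb))
  · have hZ' : 0 < Z := by linarith
    refine StrongField.exists_maxElectrons_eq (by positivity) fun N hb => ?_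
    simpa using (hVW N).2.card_le_of_hasBoundState (hVW N).1 ha hZ₀ hZ (hB ▸ hb)

theorem corollary3 (a p Z₀ : ℝ) (ha : 0 < a) (hp : 3 < p) (hZ₀ : 1 < Z₀) :
    ∃ A : ℝ, 0 < A ∧ ∀ Z B : ℝ, Z₀ ≤ Z → B = a * Z ^ p →
      (∀ (N μ ν : ℕ) (V : Fin N → ℝ → ℝ) (W : Fin N → Fin N → ℝ → ℝ),
        ν ≤ 2 * μ → StrongField.PotentialBounds μ ν V W →
        3 * Z + A * Z * Real.log Z ^ 2 < (N : ℝ) →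
        ¬ StrongField.HasBoundState Z (B ^ (-(1 / 2) : ℝ)) V W) ∧
      (∀ (μ ν : ℕ → ℕ) (V : (N : ℕ) → Fin N → ℝ → ℝ)
        (W : (N : ℕ) → Fin N → Fin N → ℝ → ℝ),
        (∀ N, ν N ≤ 2 * μ N ∧ StrongField.PotentialBounds (μ N) (ν N) (V N) (W N)) →
        ∃ n : ℕ, StrongField.maxElectrons Z (B ^ (-(1 / 2) : ℝ)) V W = (n : ℕ∞) ∧
          (n : ℝ) ≤ 3 * Z + A * Z * Real.log Z ^ 2) := by
  obtain ⟨A, hA, h⟩ := corollary3_general a p Z₀ ha hZ₀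
  refine ⟨A, hA, fun Z B hZ hB => ⟨fun N μ ν V W hνμ hVW hN => ?_, fun μ ν V W hVW => ?_⟩⟩
  · exact (h Z B hZ hB).1 (Fin N) μ ν V W (by omega) hVW (by simpa using hN)
  · exact (h Z B hZ hB).2 μ ν V W fun N => ⟨(hVW N).1.trans (by omega), (hVW N).2⟩
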